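/- Notation. Let $M$ be a smooth manifold (without boundary) with a smooth embedding $f\colon M\to\mathbb R^m$, and let $n\ge 0$. For a set $S$ let $C_k(S)$ be the set of $k$-tuples of pairwise distinct elements of $S$, and write $\underline n=\{1,\dots,n\}$. Put $A_n[M]=M^n\times (S^{m-1})^{C_2(\underline n)}\times[0,\infty]^{C_3(\underline n)}$ and let $\alpha_n\colon C_n(M)\to A_n[M]$ send $(x_i)$ to the point with coordinates $x_i$, $u_{ij}=\frac{f(x_i)-f(x_j)}{|f(x_i)-f(x_j)|}$ and $d_{ijk}=\frac{|f(x_i)-f(x_j)|}{|f(x_i)-f(x_k)|}$. Then $C_n[M]=C_n[M,f]$ is the closure of the image of $\alpha_n$ in $A_n[M]$. It carries the smooth structure of a subset of the manifold with corners $A_n[M]$ (where $[0,\infty]$ has the charts $t$ and $1/t$): a map is smooth if it locally extends to a smooth map of the ambient spaces, a diffeomorphism is a smooth bijection with smooth inverse, and an embedding is a diffeomorphism onto its image. For $x=((x_i),(u_{ij}),(d_{ijk}))\in C_n[M]$ let $T(x)$ be the tree with leaves labelled by $\underline n$ whose internal vertices are given by the following sets of leaves lying over them: the sets $\{i\}\cup\{l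 : d_{ilk}=0\}$ for those $i,k$ for which such an $l$ exists ($i,l,k$ distinct), and also $\underline n$ if $n\ge2$ and all $x_i$ are equal. The strata of $C_n[M]$ are the sets $C_T(M)=\{x : T(x)=T\}$. At an internal vertex of $T(x)$ with set of leaves $A$, all $x_i$ with $i\in A$ equal one point $p$, and an infinitesimal configuration of $x$ at this vertex consists of distinct tangent vectors in $T_pM$, one for each edge issuing from the vertex away from the root, such that, with $y_i$ ($i\in A$) the vector of the edge below the leaf $i$, one has $u_{ij}=\frac{Df(y_i-y_j)}{|Df(y_i-y_j)|}$ whenever $y_i\ne y_j$ and $d_{ijk}=\frac{|Df(y_i-y_j)|}{|Df(y_i-y_k)|}$ whenever $y_i,y_j,y_k$ are not all equal ($i,j,k\in A$ distinct). Theorem. (1) If $f\colon M\to\mathbb R^m$ and $g\colon M\to\mathbb R^{m'}$ are smooth embeddings, there is a diffeomorphism $C_n[M,f]\to C_n[M,g]$ which is the identity on $C_n(M)$. (2) $C_n[-]$ is a functor on manifolds (with chosen embeddings in Euclidean spaces) and smooth embeddings: every embedding $\varphi\colon M\to N$ (not assumed compatible with the chosen embeddings) induces an embedding $C_n[\varphi]\colon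 C_n[M]\to C_n[N]$, with $C_n[\mathrm{id}]=\mathrm{id}$ and $C_n[\psi\circ\varphi]=C_n[\psi]\circ C_n[\varphi]$, which extends the map $C_n(M)\to C_n(N)$, lifts the map $\varphi^n\colon M^n\to N^n$, and respects the stratifications: $x\in C_T(M)$ if and only if $C_n[\varphi](x)\in C_T(N)$. Moreover every $x\in C_n[M]$ has an infinitesimal configuration at each internal vertex of $T(x)$, and if $(y_i)$ is one at $p$, then $(D\varphi(y_i))$ is an infinitesimal configuration of $C_n[\varphi](x)$ at the same vertex, at $\varphi(p)$. (3) The group of diffeomorphisms of $M$ acts on $C_n[M]$ by diffeomorphisms, extending its action on $C_n(M)$ and lifting its action on $M^n$. -/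

import Mathlib

open Manifold Set
open scoped ContDiff ENNReal

universe u

noncomputable section

/-- Euclidean space `ℝ^m`. -/
abbrev EucSp (m : ℕ) : Type := EuclideanSpace ℝ (Fin m)

/-- The set `C_k(X)` of `k`-tuples of pairwise distinct points of `X`. It is used both for
configurations in a manifold and for the index sets `C_2({1,…,n})` and `C_3({1,…,n})`. -/
abbrev Conf (k : ℕ) (X : Type*) : Type _ := {x : Fin k → X // Function.Injective x}

/-- The map on configurations induced by an injective map. -/
def Conf.map {k : ℕ} {X Y : Type*} (f : X → Y) (hf : Function.Injective f) (x : Conf k X) :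
    Conf k Y :=
  ⟨f ∘ x.1, hf.comp x.2⟩

/-- A smooth embedding of a manifold `M` of dimension `d` (without boundary) in `ℝ^m`. -/
structure EuclideanEmbedding (d : ℕ) (M : Type*) [TopologicalSpace M]
    [ChartedSpace (EucSp d) M] (m : ℕ) where
  toFun : M → EucSp m
  isSmoothEmbedding : IsSmoothEmbedding 𝓘(ℝ, EucSp d) 𝓘(ℝ, EucSp m) ∞ toFun

/-- The ambient space `A_n[M] = M^n × (S^{m-1})^{C_2(n)} × [0,∞]^{C_3(n)}`. -/
abbrev AmbientSp (n m : ℕ) (M : Type*) : Type _ :=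
  (Fin n → M) × (Conf 2 (Fin n) → Metric.sphere (0 : EucSp m) 1) × (Conf 3 (Fin n) → ℝ≥0∞)

/-- The map `π_{ij}`: the unit vector in the direction of `y_i - y_j`. -/
def unitDirection {n m : ℕ} (y : Conf n (EucSp m)) (q : Conf 2 (Fin n)) :
    Metric.sphere (0 : EucSp m) 1 :=
  ⟨‖y.1 (q.1 0) - y.1 (q.1 1)‖⁻¹ • (y.1 (q.1 0) - y.1 (q.1 1)), by
    have h : y.1 (q.1 0) - y.1 (q.1 1) ≠ 0 :=
      sub_ne_zero.mpr fun e => absurd (q.2 (y.2 e)) (by decide)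
    rw [mem_sphere_zero_iff_norm, norm_smul, norm_inv, norm_norm]
    exact inv_mul_cancel₀ (norm_ne_zero_iff.mpr h)⟩

/-- The map `s_{ijk}`: the ratio `|y_i - y_j| / |y_i - y_k|`. -/
def distRatio {n m : ℕ} (y : Conf n (EucSp m)) (t : Conf 3 (Fin n)) : ℝ≥0∞ :=
  ‖y.1 (t.1 0) - y.1 (t.1 1)‖ₑ / ‖y.1 (t.1 0) - y.1 (t.1 2)‖ₑ

section Compactification

variable {d m : ℕ} {M : Type*} [TopologicalSpace M] [ChartedSpace (EucSp d) M]

/-- The map `α_n : C_n(M) → A_n[M]`. -/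
def alphaMap (n : ℕ) (f : EuclideanEmbedding d M m) (x : Conf n M) : AmbientSp n m M :=
  (x.1, unitDirection (x.map f.toFun f.isSmoothEmbedding.isEmbedding.injective),
    distRatio (x.map f.toFun f.isSmoothEmbedding.isEmbedding.injective))

/-- `C_n[M]`, the closure of the image of `α_n` in `A_n[M]`. -/
def compactConf (n : ℕ) (f : EuclideanEmbedding d M m) : Set (AmbientSp n m M) :=
  closure (range (alphaMap n f))

/-- The canonical inclusion of `C_n(M)` in `C_n[M]`. -/
def toCompactConf (n : ℕ) (f : EuclideanEmbedding d M m) (x : Conf n M) : compactConf n f :=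
  ⟨alphaMap n f x, subset_closure (mem_range_self x)⟩

/-- The vector space in which `A_n[M]` is embedded as a submanifold with corners. -/
abbrev CoordSp (n m : ℕ) : Type :=
  (Fin n → EucSp m) × (Conf 2 (Fin n) → EucSp m) × (Conf 3 (Fin n) → ℝ)

/-- The embedding of `A_n[M]` as a submanifold with corners of a vector space: `M` sits in `ℝ^m`
by the given embedding, `S^{m-1}` in `ℝ^m` as the unit sphere, and `[0,∞]`, whose charts are
`t` on `[0,∞)` and `1/t` on `(0,∞]`, is diffeomorphic to `[0,1]` by `t ↦ 1/(1+t)`. -/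
def ambientCoords {n : ℕ} (f : EuclideanEmbedding d M m) (a : AmbientSp n m M) : CoordSp n m :=
  (fun i => f.toFun (a.1 i), fun q => (a.2.1 q : EucSp m), fun t => ((1 + a.2.2 t)⁻¹).toReal)

/-- The restriction of `ambientCoords` to `C_n[M]`. -/
def compactCoords {n : ℕ} (f : EuclideanEmbedding d M m) (x : compactConf n f) : CoordSp n m :=
  ambientCoords f x.1

end Compactification

/-- Smoothness of a map between subsets of vector spaces. The sets are given as the images of
injections `κ` and `κ'`, and a map is smooth if near every point it is the restriction of a
`C^∞` map defined on an open set. -/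
def SmoothVia {X Y V W : Type*} [NormedAddCommGroup V] [NormedSpace ℝ V]
    [NormedAddCommGroup W] [NormedSpace ℝ W] (κ : X → V) (κ' : Y → W) (F : X → Y) : Prop :=
  ∀ x : X, ∃ U : Set V, IsOpen U ∧ κ x ∈ U ∧ ∃ G : V → W, ContDiffOn ℝ ∞ G U ∧
    ∀ y : X, κ y ∈ U → G (κ y) = κ' (F y)

/-- `F` is a diffeomorphism onto its image: it is injective and smooth, and (last clause) the
inverse map from `F(X)`, a subset of `W` through `κ'`, to `X` is smooth. -/
def SmoothEmbeddingVia {X Y V W : Type*} [NormedAddCommGroup V] [NormedSpace ℝ V]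
    [NormedAddCommGroup W] [NormedSpace ℝ W] (κ : X → V) (κ' : Y → W) (F : X → Y) : Prop :=
  Function.Injective F ∧ SmoothVia κ κ' F ∧ SmoothVia (fun x => κ' (F x)) κ (id : X → X)

/-- A diffeomorphism between the compactified configuration spaces of two manifolds. -/
structure CompactConfDiffeo (n : ℕ) {d m d' m' : ℕ} {M N : Type*}
    [TopologicalSpace M] [ChartedSpace (EucSp d) M]
    [TopologicalSpace N] [ChartedSpace (EucSp d') N]
    (f : EuclideanEmbedding d M m) (g : EuclideanEmbedding d' N m')
    extends compactConf n f ≃ compactConf n g where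
  smooth_toFun : SmoothVia (compactCoords f) (compactCoords g) toFun
  smooth_invFun : SmoothVia (compactCoords g) (compactCoords f) invFun

section Strata

variable {n m : ℕ} {M : Type*}

/-- The relation `(i,j),k ∈ R(x)`: the indices are distinct and `d_{ijk} = 0`. -/
def Excludes (x : AmbientSp n m M) (i j k : Fin n) : Prop :=
  ∃ h : Function.Injective ![i, j, k], x.2.2 ⟨![i, j, k], h⟩ = 0

/-- The tree `T(x)`. A tree with leaves labelled by `1,…,n` is given by its parenthesization,
that is by the collection, over the internal vertices `v`, of the sets of labels of the leaves
over `v`. For `T(x)` these are the sets consisting of `i` and of all `l` with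
`(i,l),k ∈ R(x)`, when there is such an `l`, and, if all `x_i` are equal, the set of
all labels (which stands for the addition of a new root; for `n ≤ 1` there is nothing to add,
since an internal vertex may not be bivalent). -/
def treeOf (x : AmbientSp n m M) : Set (Set (Fin n)) :=
  {A | (∃ i j k, Excludes x i j k ∧ A = {l | l = i ∨ Excludes x i l k}) ∨
    (1 < n ∧ (∀ i j, x.1 i = x.1 j) ∧ A = univ)}

/-- Two leaves `i`, `j` over the internal vertex `A` lie over the same edge issuing from `A`. -/
def SameEdge (T : Set (Set (Fin n))) (A : Set (Fin n)) (i j : Fin n) : Prop :=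
  i = j ∨ ∃ B ∈ T, B ⊂ A ∧ i ∈ B ∧ j ∈ B

variable {d : ℕ} [TopologicalSpace M] [ChartedSpace (EucSp d) M]

/-- The stratum `C_T(M)` of `C_n[M]`. -/
def stratum (f : EuclideanEmbedding d M m) (T : Set (Set (Fin n))) : Set (compactConf n f) :=
  {x | treeOf x.1 = T}

/-- The differential of the embedding `M → ℝ^m`, applied to a tangent vector. -/
def EuclideanEmbedding.push (f : EuclideanEmbedding d M m) (p : M)
    (v : TangentSpace 𝓘(ℝ, EucSp d) p) : EucSp m :=
  mfderiv 𝓘(ℝ, EucSp d) 𝓘(ℝ, EucSp m) f.toFun p v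

/-- The infinitesimal configuration of `x` at the internal vertex `A` of `T(x)` is the class,
modulo translations and positive scalings of `T_pM`, of the tangent vectors `y_i`, `i ∈ A`.
They form one vector for each edge issuing from the vertex (`y_i` is the vector of the edge
under the leaf `i`; the values of `y` outside `A` are irrelevant), these vectors are distinct,
and the coordinates `u_{ij}` and `d_{ijk}` of `x` are those of the configuration. -/
structure IsInfinitesimalConf (f : EuclideanEmbedding d M m) (x : AmbientSp n m M)
    (A : Set (Fin n)) (p : M) (y : Fin n → TangentSpace 𝓘(ℝ, EucSp d) p) : Prop where
  base : ∀ i ∈ A, x.1 i = p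
  distinct : ∀ i ∈ A, ∀ j ∈ A, y i = y j ↔ SameEdge (treeOf x) A i j
  direction : ∀ q : Conf 2 (Fin n), (∀ a, q.1 a ∈ A) → y (q.1 0) ≠ y (q.1 1) →
    (x.2.1 q : EucSp m) =
      ‖f.push p (y (q.1 0) - y (q.1 1))‖⁻¹ • f.push p (y (q.1 0) - y (q.1 1))
  ratio : ∀ t : Conf 3 (Fin n), (∀ a, t.1 a ∈ A) →
    ¬ (y (t.1 0) = y (t.1 1) ∧ y (t.1 0) = y (t.1 2)) →
    x.2.2 t = ‖f.push p (y (t.1 0) - y (t.1 1))‖ₑ / ‖f.push p (y (t.1 0) - y (t.1 2))‖ₑ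

end Strata

/-- A smooth manifold (without boundary) with a chosen embedding in some Euclidean space. -/
structure EmbeddedManifold where
  dim : ℕ
  ambientDim : ℕ
  carrier : Type u
  [top : TopologicalSpace carrier]
  [charted : ChartedSpace (EucSp dim) carrier]
  [manifold : IsManifold 𝓘(ℝ, EucSp dim) ∞ carrier]
  emb : EuclideanEmbedding dim carrier ambientDim

attribute [instance] EmbeddedManifold.top EmbeddedManifold.charted EmbeddedManifold.manifold

/-- A smooth embedding `M → N` (no compatibility with the chosen embeddings in Euclidean
spaces is required). -/
structure ManifoldEmb (X Y : EmbeddedManifold) where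
  toFun : X.carrier → Y.carrier
  isSmoothEmbedding : IsSmoothEmbedding 𝓘(ℝ, EucSp X.dim) 𝓘(ℝ, EucSp Y.dim) ∞ toFun

/-- The identity embedding. -/
def ManifoldEmb.refl (X : EmbeddedManifold) : ManifoldEmb X X :=
  ⟨id, IsSmoothEmbedding.id⟩

/-- The differential of an embedding, applied to a tangent vector. -/
def ManifoldEmb.push {X Y : EmbeddedManifold} (φ : ManifoldEmb X Y) (p : X.carrier)
    (v : TangentSpace 𝓘(ℝ, EucSp X.dim) p) : TangentSpace 𝓘(ℝ, EucSp Y.dim) (φ.toFun p) :=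
  mfderiv 𝓘(ℝ, EucSp X.dim) 𝓘(ℝ, EucSp Y.dim) φ.toFun p v

end

open Filter Topology MeasureTheory

/-! Everything reduces to comparing two injections of one set into Euclidean spaces, `f` and `h = g
∘ φ`, each of which is locally a smooth function of the other. One direction (`S`) is smoothness of
`φ`; the other (`S'`) comes from local smooth left inverses of immersions.

The key point is that the secant `(h(x_i) - h(x_j)) / |f(x_i) - f(x_j)|` extends smoothly over
collisions. If `h = H ∘ f` near a collision point, Hadamard's lemma gives `H(a) - H(b) = A(a,b)(a -
b)` with `A` smooth, so the secant is `A` applied to `u_ij`, a smooth function `W_ij` of the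
coordinates. It does not vanish at limits of configurations, because `f` is locally Lipschitz in
terms of `h`. Hence the new direction `W_ij / |W_ij|` and the new ratio `d_ijk |W_ij| / |W_ik|` are
smooth up to the boundary (`exists_contDiffAt_confCoords`). Exchanging `f` and `h` gives a smooth
inverse. As configurations are dense, the extension is unique, and functoriality, independence of
the embedding and the group action follow.

Trees are determined by base points and by which differences are little-o of which others along
configurations tending to `x`. Both embeddings give differences of the same order (`isTheta_sub`),
so strata are preserved. Infinitesimal configurations are transported by limits of secants
(`tendsto_secant`); they exist by rescaling configurations along an ultrafilter and using
compactness (`exists_isInfinitesimalConf`). -/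

/-! ### Hadamard's lemma and germs of smooth maps -/

theorem contDiff_integral_Icc_of_contDiff {P F : Type*} [NormedAddCommGroup P] [NormedSpace ℝ P]
    [NormedAddCommGroup F] [NormedSpace ℝ F] [CompleteSpace F]
    {Φ : P → ℝ → F} (hΦ : ContDiff ℝ ∞ fun q : P × ℝ => Φ q.1 q.2) :
    ContDiff ℝ ∞ fun q => ∫ t in Icc (0 : ℝ) 1, Φ q t := by
  -- The integral is the value at `0` of the convolution of the indicator of `[0,1]` with `s ↦ ρ(s)
  -- Φ(q,-s)`. The bump is `1` on `[-1,1]`, so it does not change this value, and it supplies the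
  -- compact support.
  let ρ : ContDiffBump (0 : ℝ) := ⟨1, 2, by norm_num, by norm_num⟩
  have key := contDiffOn_convolution_right_with_param (𝕜 := ℝ) (μ := (volume : Measure ℝ))
    (n := ⊤) (f := indicator (Icc (0 : ℝ) 1) fun _ => (1 : ℝ)) (ContinuousLinearMap.lsmul ℝ ℝ)
    (g := fun (q : P) s => ρ s • Φ q (-s)) (s := univ) (k := Metric.closedBall 0 2) isOpen_univ
    (isCompact_closedBall 0 2)
    (fun q s _ hs => by
      have : ρ s = 0 := by
        apply ρ.zero_of_le_dist
        exact (not_le.mp hs).le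
      simp [this])
    (((integrableOn_const (by simp)).integrable_indicator measurableSet_Icc).locallyIntegrable)
    (by
      apply ContDiff.contDiffOn
      have h1 : ContDiff ℝ ∞ fun q : P × ℝ => Φ q.1 (-q.2) :=
        hΦ.comp (contDiff_fst.prodMk contDiff_snd.neg)
      exact (ρ.contDiff.comp contDiff_snd).smul h1)
  have h2 : ContDiff ℝ ∞ fun q : P => (q, (0 : ℝ)) := contDiff_id.prodMk contDiff_const
  have h3 := key.comp h2.contDiffOn (s := univ) (fun q _ => by simp)
  convert contDiffOn_univ.mp h3 using 1
  ext q
  symm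
  simp only [Function.comp, convolution]
  rw [← integral_indicator measurableSet_Icc]
  refine integral_congr_ae (Eventually.of_forall fun t => ?_)
  by_cases ht : t ∈ Icc (0 : ℝ) 1
  · have : ρ (0 - t) = 1 := by
      apply ρ.one_of_mem_closedBall
      simp only [zero_sub, mem_closedBall_zero_iff, norm_neg, Real.norm_eq_abs]
      exact abs_le.mpr ⟨by linarith [ht.1], ht.2⟩
    simp only [zero_sub] at this
    simp [ht, this]
  · simp [ht]

/-- Hadamard's lemma: integrate the derivative along the segment from `q.2` to `q.1`. Multiplying by
a bump function first makes the integrand smooth everywhere. -/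
theorem exists_contDiff_slope {E W : Type*} [NormedAddCommGroup E] [NormedSpace ℝ E]
    [FiniteDimensional ℝ E] [NormedAddCommGroup W] [NormedSpace ℝ W] [CompleteSpace W]
    {H : E → W} {p : E} (hH : ∀ᶠ y in 𝓝 p, ContDiffAt ℝ ∞ H y) :
    ∃ A : E × E → E →L[ℝ] W, ContDiff ℝ ∞ A ∧
      ∀ᶠ q in 𝓝 (p, p), H q.1 - H q.2 = A q (q.1 - q.2) := by
  obtain ⟨ε, hε, hball⟩ := Metric.eventually_nhds_iff_ball.mp hH
  let χ : ContDiffBump p := ⟨ε / 3, ε / 2, by positivity, by linarith⟩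
  let K : E → W := fun y => χ y • H y
  have hK : ContDiff ℝ ∞ K := by
    rw [contDiff_iff_contDiffAt]
    intro y
    by_cases hy : y ∈ Metric.ball p ε
    · exact χ.contDiffAt.smul (hball y hy)
    · have : K =ᶠ[𝓝 y] fun _ => 0 := by
        have h1 : {y | ε / 2 < dist y p} ∈ 𝓝 y := by
          apply (isOpen_lt continuous_const (continuous_id.dist continuous_const)).mem_nhds
          simp only [Metric.mem_ball, not_lt] at hy
          simp only [mem_ofPred_eq, id]
          linarith
        filter_upwards [h1] with y' hy'
        have : χ y' = 0 := χ.zero_of_le_dist hy'.le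
        simp [K, this]
      exact contDiffAt_const.congr_of_eventuallyEq this
  refine ⟨fun q => ∫ t in Icc (0 : ℝ) 1, fderiv ℝ K (q.2 + t • (q.1 - q.2)), ?_, ?_⟩
  · apply contDiff_integral_Icc_of_contDiff
      (Φ := fun (q : E × E) t => fderiv ℝ K (q.2 + t • (q.1 - q.2)))
    have h1 : ContDiff ℝ ∞ (fderiv ℝ K) := hK.fderiv_right (by simp)
    refine h1.comp ?_
    fun_prop
  · have hev : ∀ᶠ y in 𝓝 p, K y = H y := by
      filter_upwards [χ.eventuallyEq_one] with y hy
      simp [K, hy]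
    have h2 : ∀ᶠ q : E × E in 𝓝 (p, p), K q.1 = H q.1 ∧ K q.2 = H q.2 :=
      (continuous_fst.tendsto (p, p) |>.eventually hev).and
        (continuous_snd.tendsto (p, p) |>.eventually hev)
    filter_upwards [h2] with q hq
    rw [← hq.1, ← hq.2]
    have hd : ∀ t : ℝ, HasDerivAt (fun t : ℝ => K (q.2 + t • (q.1 - q.2)))
        (fderiv ℝ K (q.2 + t • (q.1 - q.2)) (q.1 - q.2)) t := fun t => by
      have h3 : HasDerivAt (fun t : ℝ => q.2 + t • (q.1 - q.2)) (q.1 - q.2) t := by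
        simpa using ((hasDerivAt_id t).smul_const (q.1 - q.2)).const_add q.2
      exact ((hK.differentiable (by simp)).differentiableAt.hasFDerivAt).comp_hasDerivAt t h3
    have hcont : Continuous fun t : ℝ => fderiv ℝ K (q.2 + t • (q.1 - q.2)) :=
      (hK.continuous_fderiv (by simp)).comp (by fun_prop)
    have h4 := intervalIntegral.integral_eq_sub_of_hasDerivAt (a := 0) (b := 1)
      (fun t _ => hd t) ((hcont.clm_apply continuous_const).intervalIntegrable _ _)
    rw [ContinuousLinearMap.integral_apply]
    · rw [integral_Icc_eq_integral_Ioc, ← intervalIntegral.integral_of_le zero_le_one, h4]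
      simp
    · exact hcont.integrableOn_Icc

theorem smoothVia_iff_eventually {X Y V W : Type*} [NormedAddCommGroup V] [NormedSpace ℝ V]
    [NormedAddCommGroup W] [NormedSpace ℝ W] {κ : X → V} {κ' : Y → W} {F : X → Y} :
    SmoothVia κ κ' F ↔ ∀ x, ∃ G : V → W, ∀ᶠ v in 𝓝 (κ x),
      ContDiffAt ℝ ∞ G v ∧ ∀ y, κ y = v → G v = κ' (F y) := by
  refine forall_congr' fun x => ⟨?_, ?_⟩
  · rintro ⟨U, hU, hx, G, hG, h⟩
    refine ⟨G, ?_⟩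
    filter_upwards [hU.mem_nhds hx] with v hv
    exact ⟨hG.contDiffAt (hU.mem_nhds hv), fun y hy => hy ▸ h y (hy ▸ hv)⟩
  · rintro ⟨G, hG⟩
    obtain ⟨U, hU, hUo, hx⟩ := mem_nhds_iff.mp hG
    exact ⟨U, hUo, hx, G, fun v hv => (hU hv).1.contDiffWithinAt,
      fun y hy => (hU hy).2 y rfl⟩

/-! ### Limits and Lipschitz bounds under a smooth change of embedding -/

section Transfer

variable {X ι : Type*} {V W : Type*} [NormedAddCommGroup V] [NormedSpace ℝ V]
    [NormedAddCommGroup W] [NormedSpace ℝ W] {f : X → V} {h : X → W}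

theorem SmoothVia.tendsto (S : SmoothVia f h id) {p : X} {u : ι → X} {l : Filter ι}
    (hu : Tendsto (fun a => f (u a)) l (𝓝 (f p))) :
    Tendsto (fun a => h (u a)) l (𝓝 (h p)) := by
  obtain ⟨G, hG⟩ := smoothVia_iff_eventually.mp S p
  have h0 := hG.self_of_nhds
  have h1 : Tendsto (fun a => G (f (u a))) l (𝓝 (G (f p))) := h0.1.continuousAt.tendsto.comp hu
  rw [h0.2 p rfl] at h1
  refine h1.congr' ?_
  filter_upwards [hu.eventually hG] with a ha
  exact ha.2 _ rfl

/-- With equal limits this is the local Lipschitz bound from strict differentiability. With distinct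
limits the right side stays away from `0` and the left side is bounded. -/
theorem SmoothVia.isBigO_sub (S : SmoothVia f h id) (hf : Function.Injective f) {p p' : X}
    {u u' : ι → X} {l : Filter ι} (hu : Tendsto (fun a => f (u a)) l (𝓝 (f p)))
    (hu' : Tendsto (fun a => f (u' a)) l (𝓝 (f p'))) :
    (fun a => h (u a) - h (u' a)) =O[l] fun a => f (u a) - f (u' a) := by
  by_cases hp : p = p'
  · subst hp
    obtain ⟨G, hG⟩ := smoothVia_iff_eventually.mp S p
    have h1 := (hG.self_of_nhds.1.hasStrictFDerivAt (by simp)).isBigO_sub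
    have h2 := h1.comp_tendsto (hu.prodMk_nhds hu')
    refine h2.congr' ?_ EventuallyEq.rfl
    filter_upwards [hu.eventually hG, hu'.eventually hG] with a ha ha'
    simp only [Function.comp, ha.2 _ rfl, ha'.2 _ rfl, id]
  · have h1 : Tendsto (fun a => h (u a) - h (u' a)) l (𝓝 (h p - h p')) :=
      (S.tendsto hu).sub (S.tendsto hu')
    have h2 : Tendsto (fun a => f (u a) - f (u' a)) l (𝓝 (f p - f p')) := hu.sub hu'
    have hne : f p - f p' ≠ 0 := sub_ne_zero.mpr fun e => hp (hf e)
    refine (h1.isBigO_one ℝ).trans ?_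
    exact ((Asymptotics.isBigO_const_left_iff_pos_le_norm one_ne_zero).mpr
      ⟨‖f p - f p'‖ / 2, half_pos (norm_pos_iff.mpr hne),
        (h2.norm.eventually_const_lt (half_lt_self (norm_pos_iff.mpr hne))).mono fun a => le_of_lt⟩)

end Transfer

/-! ### Smooth change of coordinates up to the boundary -/

section Core

variable {X : Type*} {n m m' : ℕ} {f : X → EucSp m} {h : X → EucSp m'}

/-- The coordinates of a configuration, given by a map to a Euclidean space. -/
noncomputable def confCoords (n : ℕ) (f : X → EucSp m) (c : Conf n X) : CoordSp n m :=
  (fun i => f (c.1 i),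
    fun q => ‖f (c.1 (q.1 0)) - f (c.1 (q.1 1))‖⁻¹ • (f (c.1 (q.1 0)) - f (c.1 (q.1 1))),
    fun t => (1 + ‖f (c.1 (t.1 0)) - f (c.1 (t.1 1))‖ / ‖f (c.1 (t.1 0)) - f (c.1 (t.1 2))‖)⁻¹)

/-- The filter of configurations whose coordinates are near a given point. -/
noncomputable def confNhds (f : X → EucSp m) (z : CoordSp n m) : Filter (Conf n X) :=
  comap (confCoords n f) (𝓝 z)

theorem tendsto_confNhds {ι : Type*} {l : Filter ι} {u : ι → Conf n X} {z : CoordSp n m} :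
    Tendsto u l (confNhds f z) ↔ Tendsto (fun a => confCoords n f (u a)) l (𝓝 z) :=
  tendsto_comap_iff

theorem tendsto_confCoords (z : CoordSp n m) : Tendsto (confCoords n f) (confNhds f z) (𝓝 z) :=
  tendsto_comap

theorem confNhds_neBot {z : CoordSp n m} :
    (confNhds f z).NeBot ↔ z ∈ closure (range (confCoords n f)) := by
  rw [mem_closure_iff_nhds, confNhds, comap_neBot_iff]
  refine forall₂_congr fun U _ => ⟨?_, ?_⟩
  · rintro ⟨c, hc⟩
    exact ⟨_, hc, mem_range_self c⟩
  · rintro ⟨_, hc, c, rfl⟩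
    exact ⟨c, hc⟩

theorem tendsto_point {ι : Type*} {l : Filter ι} {u : ι → Conf n X} {z : CoordSp n m}
    (hu : Tendsto u l (confNhds f z)) (i : Fin n) :
    Tendsto (fun a => f ((u a).1 i)) l (𝓝 (z.1 i)) :=
  (tendsto_pi_nhds.mp ((continuous_fst.tendsto z).comp (tendsto_confNhds.mp hu))) i

theorem tendsto_direction {ι : Type*} {l : Filter ι} {u : ι → Conf n X} {z : CoordSp n m}
    (hu : Tendsto u l (confNhds f z)) (q : Conf 2 (Fin n)) :
    Tendsto (fun a => (confCoords n f (u a)).2.1 q) l (𝓝 (z.2.1 q)) :=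
  (tendsto_pi_nhds.mp ((continuous_snd.fst.tendsto z).comp (tendsto_confNhds.mp hu))) q

theorem Conf.apply_ne {k : ℕ} (c : Conf n X) (q : Conf k (Fin n)) {a b : Fin k} (h : a ≠ b) :
    c.1 (q.1 a) ≠ c.1 (q.1 b) := fun e => h (q.2 (c.2 e))

/-- Where `x_i` and `x_j` collide, `W` is the Hadamard slope applied to the coordinate `u_ij`; where
they stay apart, the quotient is already smooth. -/
theorem exists_contDiffAt_secant (hf : Function.Injective f) (hh : Function.Injective h)
    (S : SmoothVia f h id) (S' : SmoothVia h f id) {z : CoordSp n m}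
    (hz : z ∈ closure (range (confCoords n f))) {p : Fin n → X} (hp : ∀ i, z.1 i = f (p i))
    (q : Conf 2 (Fin n)) :
    ∃ W : CoordSp n m → EucSp m', W z ≠ 0 ∧ ∀ᶠ v in 𝓝 z, ContDiffAt ℝ ∞ W v ∧
      ∀ c, confCoords n f c = v → W v = ‖f (c.1 (q.1 0)) - f (c.1 (q.1 1))‖⁻¹ •
        (h (c.1 (q.1 0)) - h (c.1 (q.1 1))) := by
  have hcoord : ∀ i, Tendsto (fun v : CoordSp n m => v.1 i) (𝓝 z) (𝓝 (f (p i))) := fun i => by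
    rw [← hp i]
    exact ((continuous_apply i).comp continuous_fst).tendsto z
  have hex : ∃ W : CoordSp n m → EucSp m', ∀ᶠ v in 𝓝 z, ContDiffAt ℝ ∞ W v ∧
      ∀ c, confCoords n f c = v → W v = ‖f (c.1 (q.1 0)) - f (c.1 (q.1 1))‖⁻¹ •
        (h (c.1 (q.1 0)) - h (c.1 (q.1 1))) := by
    by_cases he : p (q.1 0) = p (q.1 1)
    · obtain ⟨G, hG⟩ := smoothVia_iff_eventually.mp S (p (q.1 0))
      obtain ⟨A, hA, hA'⟩ := exists_contDiff_slope (hG.mono fun v hv => hv.1)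
      refine ⟨fun v => A (v.1 (q.1 0), v.1 (q.1 1)) (v.2.1 q), ?_⟩
      have h0 := hcoord (q.1 0)
      have h1 := hcoord (q.1 1)
      rw [← he] at h1
      filter_upwards [(h0.prodMk_nhds h1).eventually hA', h0.eventually hG, h1.eventually hG]
        with v hv hv0 hv1
      constructor
      · apply ContDiff.contDiffAt
        have hA2 : ContDiff ℝ ∞ fun v : CoordSp n m => A (v.1 (q.1 0), v.1 (q.1 1)) :=
          hA.comp (by fun_prop)
        exact hA2.clm_apply (by fun_prop)
      · rintro c rfl
        have e0 := hv0.2 (c.1 (q.1 0)) rfl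
        have e1 := hv1.2 (c.1 (q.1 1)) rfl
        simp only [confCoords, id] at hv e0 e1 ⊢
        rw [e0, e1] at hv
        rw [map_smul, ← hv]
    · obtain ⟨G, hG⟩ := smoothVia_iff_eventually.mp S (p (q.1 0))
      obtain ⟨G', hG'⟩ := smoothVia_iff_eventually.mp S (p (q.1 1))
      refine ⟨fun v => ‖v.1 (q.1 0) - v.1 (q.1 1)‖⁻¹ • (G (v.1 (q.1 0)) - G' (v.1 (q.1 1))), ?_⟩
      have h0 := hcoord (q.1 0)
      have h1 := hcoord (q.1 1)
      have hne : f (p (q.1 0)) - f (p (q.1 1)) ≠ 0 := sub_ne_zero.mpr fun e => he (hf e)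
      filter_upwards [(h0.sub h1).eventually_ne hne, h0.eventually hG, h1.eventually hG']
        with v hv hv0 hv1
      constructor
      · have hd : ContDiffAt ℝ ∞ (fun v : CoordSp n m => v.1 (q.1 0) - v.1 (q.1 1)) v :=
          ContDiff.contDiffAt (by fun_prop)
        refine ((hd.norm ℝ hv).inv (norm_ne_zero_iff.mpr hv)).smul (ContDiffAt.sub ?_ ?_)
        · exact ContDiffAt.comp v hv0.1 (ContDiff.contDiffAt (by fun_prop))
        · exact ContDiffAt.comp v hv1.1 (ContDiff.contDiffAt (by fun_prop))
      · rintro c rfl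
        have e0 := hv0.2 (c.1 (q.1 0)) rfl
        have e1 := hv1.2 (c.1 (q.1 1)) rfl
        simp only [confCoords, id] at e0 e1 ⊢
        rw [e0, e1]
  obtain ⟨W, hW⟩ := hex
  refine ⟨W, ?_, hW⟩
  have := confNhds_neBot.mpr hz
  have ht : ∀ i, Tendsto (fun c : Conf n X => f (c.1 i)) (confNhds f z) (𝓝 (f (p i))) := fun i =>
    hp i ▸ tendsto_point tendsto_id i
  -- The Lipschitz bound of `f` in terms of `h` reads `1 ≤ C |W|` at configurations; passing to the
  -- limit at `z` excludes `W z = 0`.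
  obtain ⟨C, hC⟩ := (S'.isBigO_sub hh (S.tendsto (ht (q.1 0))) (S.tendsto (ht (q.1 1)))).bound
  have hlim : Tendsto (fun c => C * ‖W (confCoords n f c)‖) (confNhds f z) (𝓝 (C * ‖W z‖)) :=
    ((hW.self_of_nhds.1.continuousAt.tendsto.comp (tendsto_confCoords z)).norm).const_mul C
  have hge : 1 ≤ C * ‖W z‖ := by
    refine ge_of_tendsto hlim ?_
    filter_upwards [hC, (tendsto_confCoords z).eventually hW] with c hc hc'
    have hpos : 0 < ‖f (c.1 (q.1 0)) - f (c.1 (q.1 1))‖ :=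
      norm_pos_iff.mpr (sub_ne_zero.mpr fun e => c.apply_ne q (by decide) (hf e))
    rw [hc'.2 c rfl, norm_smul, norm_inv, norm_norm, mul_left_comm, ← div_eq_inv_mul, le_div_iff₀ hpos]
    simpa using hc
  intro h0
  rw [h0] at hge
  norm_num at hge

/-- The first two indices of a triple. -/
def Conf.pair₁ {Y : Type*} (t : Conf 3 Y) : Conf 2 Y :=
  ⟨t.1 ∘ ![0, 1], t.2.comp (by decide)⟩

/-- The first and the last index of a triple. -/
def Conf.pair₂ {Y : Type*} (t : Conf 3 Y) : Conf 2 Y :=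
  ⟨t.1 ∘ ![0, 2], t.2.comp (by decide)⟩

/-- The new directions are the normalized secants, and each ratio is multiplied by the quotient `r`
of the norms of two secants. -/
theorem exists_contDiffAt_confCoords (hf : Function.Injective f) (hh : Function.Injective h)
    (S : SmoothVia f h id) (S' : SmoothVia h f id) {z : CoordSp n m}
    (hz : z ∈ closure (range (confCoords n f))) {p : Fin n → X} (hp : ∀ i, z.1 i = f (p i)) :
    ∃ G : CoordSp n m → CoordSp n m', ∀ᶠ v in 𝓝 z, ContDiffAt ℝ ∞ G v ∧
      ∀ c, confCoords n f c = v → G v = confCoords n h c := by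
  choose W hWz hW using fun q => exists_contDiffAt_secant hf hh S S' hz hp q
  choose H hH using fun i => smoothVia_iff_eventually.mp S (p i)
  have hcoord : ∀ i, Tendsto (fun v : CoordSp n m => v.1 i) (𝓝 z) (𝓝 (f (p i))) := fun i => by
    rw [← hp i]
    exact ((continuous_apply i).comp continuous_fst).tendsto z
  let r : Conf 3 (Fin n) → CoordSp n m → ℝ := fun t v => ‖W t.pair₁ v‖ / ‖W t.pair₂ v‖
  -- In the coordinate `s = 1/(1+d)` the map `d ↦ r d` becomes `s ↦ s / (s + r(1-s))`, which is
  -- smooth at both ends of `[0,∞]`. The denominator is positive for `r > 0` and `0 ≤ s ≤ 1`.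
  let D : Conf 3 (Fin n) → CoordSp n m → ℝ := fun t v => v.2.2 t + r t v * (1 - v.2.2 t)
  have hWc : ∀ q, ContinuousAt (W q) z := fun q => (hW q).self_of_nhds.1.continuousAt
  have hWn : ∀ᶠ v in 𝓝 z, ∀ q, W q v ≠ 0 :=
    eventually_all.mpr fun q => (hWc q).eventually_ne (hWz q)
  have hs : ∀ t, z.2.2 t ∈ Icc (0 : ℝ) 1 := fun t => by
    have hcl : IsClosed {v : CoordSp n m | v.2.2 t ∈ Icc (0 : ℝ) 1} :=
      isClosed_Icc.preimage (by fun_prop)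
    refine closure_minimal ?_ hcl hz
    rintro _ ⟨c, rfl⟩
    have : 0 ≤ ‖f (c.1 (t.1 0)) - f (c.1 (t.1 1))‖ / ‖f (c.1 (t.1 0)) - f (c.1 (t.1 2))‖ := by
      positivity
    simp only [confCoords, mem_ofPred_eq]
    exact ⟨by positivity, inv_le_one_of_one_le₀ (by linarith)⟩
  have hDc : ∀ t, ContinuousAt (D t) z := fun t => by
    have h2 : ContinuousAt (fun v : CoordSp n m => v.2.2 t) z :=
      Continuous.continuousAt (by fun_prop)
    exact h2.add ((((hWc _).norm.div (hWc _).norm (norm_ne_zero_iff.mpr (hWz _)))).mul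
      (continuousAt_const.sub h2))
  have hDz : ∀ t, D t z ≠ 0 := fun t => by
    have hr : 0 < r t z := div_pos (norm_pos_iff.mpr (hWz _)) (norm_pos_iff.mpr (hWz _))
    have := hs t
    simp only [D]
    rcases this.1.eq_or_lt with h0 | h0
    · rw [← h0]; simpa using hr.ne'
    · have : 0 ≤ r t z * (1 - z.2.2 t) := mul_nonneg hr.le (by linarith [this.2])
      exact ne_of_gt (by linarith)
  have hDn : ∀ᶠ v in 𝓝 z, ∀ t, D t v ≠ 0 :=
    eventually_all.mpr fun t => (hDc t).eventually_ne (hDz t)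
  refine ⟨fun v => (fun i => H i (v.1 i), fun q => ‖W q v‖⁻¹ • W q v,
    fun t => v.2.2 t / D t v), ?_⟩
  filter_upwards [hWn, hDn, eventually_all.mpr hW,
    eventually_all.mpr fun i => (hcoord i).eventually (hH i)] with v hWv hDv hWv' hHv
  constructor
  · have hWnorm : ∀ q, ContDiffAt ℝ ∞ (fun v => ‖W q v‖) v := fun q => (hWv' q).1.norm ℝ (hWv q)
    refine ContDiffAt.prodMk ?_ (ContDiffAt.prodMk ?_ ?_)
    · exact contDiffAt_pi.mpr fun i =>
        ContDiffAt.comp v (hHv i).1 (ContDiff.contDiffAt (by fun_prop))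
    · exact contDiffAt_pi.mpr fun q =>
        ((hWnorm q).inv (norm_ne_zero_iff.mpr (hWv q))).smul (hWv' q).1
    · refine contDiffAt_pi.mpr fun t => ?_
      have h2 : ContDiffAt ℝ ∞ (fun v : CoordSp n m => v.2.2 t) v :=
        ContDiff.contDiffAt (by fun_prop)
      exact h2.div (h2.add (((hWnorm _).div (hWnorm _) (norm_ne_zero_iff.mpr (hWv _))).mul
        (contDiffAt_const.sub h2))) (hDv t)
  · rintro c rfl
    have hfpos : ∀ {k : ℕ} (q : Conf k (Fin n)) (a b : Fin k), a ≠ b →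
        0 < ‖f (c.1 (q.1 a)) - f (c.1 (q.1 b))‖ := fun q a b hab =>
      norm_pos_iff.mpr (sub_ne_zero.mpr fun e => c.apply_ne q hab (hf e))
    have hhpos : ∀ {k : ℕ} (q : Conf k (Fin n)) (a b : Fin k), a ≠ b →
        0 < ‖h (c.1 (q.1 a)) - h (c.1 (q.1 b))‖ := fun q a b hab =>
      norm_pos_iff.mpr (sub_ne_zero.mpr fun e => c.apply_ne q hab (hh e))
    have hWq := fun q => (hWv' q).2 c rfl
    have hWqn : ∀ q, ‖W q (confCoords n f c)‖ = ‖f (c.1 (q.1 0)) - f (c.1 (q.1 1))‖⁻¹ *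
        ‖h (c.1 (q.1 0)) - h (c.1 (q.1 1))‖ := fun q => by
      rw [hWq, norm_smul, norm_inv, norm_norm]
    refine Prod.ext (funext fun i => (hHv i).2 _ rfl) (Prod.ext (funext fun q => ?_)
      (funext fun t => ?_))
    · have := hfpos q 0 1 (by decide)
      have := hhpos q 0 1 (by decide)
      change ‖W q (confCoords n f c)‖⁻¹ • W q (confCoords n f c) =
        ‖h (c.1 (q.1 0)) - h (c.1 (q.1 1))‖⁻¹ • (h (c.1 (q.1 0)) - h (c.1 (q.1 1)))
      rw [hWqn, hWq, smul_smul]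
      congr 1
      field_simp
    · have h1 := hfpos t 0 1 (by decide)
      have h2 := hfpos t 0 2 (by decide)
      have h3 := hhpos t 0 1 (by decide)
      have h4 := hhpos t 0 2 (by decide)
      simp only [D, r, hWqn]
      simp only [Conf.pair₁, Conf.pair₂, Function.comp, Matrix.cons_val_zero, Matrix.cons_val_one,
        confCoords]
      generalize ‖f (c.1 (t.1 0)) - f (c.1 (t.1 1))‖ = a1 at *
      generalize ‖f (c.1 (t.1 0)) - f (c.1 (t.1 2))‖ = a2 at *
      generalize ‖h (c.1 (t.1 0)) - h (c.1 (t.1 1))‖ = b1 at *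
      generalize ‖h (c.1 (t.1 0)) - h (c.1 (t.1 2))‖ = b2 at *
      have e1 : (1 + a1 / a2)⁻¹ = a2 / (a1 + a2) := by field_simp; ring
      have e2 : 1 - a2 / (a1 + a2) = a1 / (a1 + a2) := by field_simp; ring
      rw [e1, e2]
      field_simp

end Core

/-! ### The compactification inside its coordinate space -/

section Coordinates

variable {n d m : ℕ} {M : Type*} [TopologicalSpace M] [ChartedSpace (EucSp d) M]
  (f : EuclideanEmbedding d M m)

theorem EuclideanEmbedding.injective : Function.Injective f.toFun :=
  f.isSmoothEmbedding.isEmbedding.injective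

theorem continuous_toReal_inv_one_add : Continuous fun t : ℝ≥0∞ => ((1 + t)⁻¹).toReal := by
  have h1 : Continuous fun t : ℝ≥0∞ => (1 + t)⁻¹ := by fun_prop
  refine ENNReal.continuousOn_toReal.comp_continuous h1 fun t => ?_
  simp

theorem injective_toReal_inv_one_add :
    Function.Injective fun t : ℝ≥0∞ => ((1 + t)⁻¹).toReal := by
  intro a b hab
  have h := (ENNReal.toReal_eq_toReal_iff' (by simp) (by simp)).mp hab
  exact (ENNReal.add_right_inj ENNReal.one_ne_top).mp (inv_injective h)

theorem isEmbedding_ambientCoords :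
    IsEmbedding (ambientCoords f : AmbientSp n m M → CoordSp n m) := by
  have h1 : IsEmbedding (fun t : ℝ≥0∞ => ((1 + t)⁻¹).toReal) :=
    (continuous_toReal_inv_one_add.isClosedEmbedding injective_toReal_inv_one_add).isEmbedding
  exact (IsEmbedding.piMap fun _ : Fin n => f.isSmoothEmbedding.isEmbedding).prodMap
    ((IsEmbedding.piMap fun _ : Conf 2 (Fin n) => IsEmbedding.subtypeVal).prodMap
      (IsEmbedding.piMap fun _ : Conf 3 (Fin n) => h1))

theorem injective_compactCoords :
    Function.Injective (compactCoords f : compactConf n f → CoordSp n m) :=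
  (isEmbedding_ambientCoords f).injective.comp Subtype.val_injective

theorem ambientCoords_alphaMap (c : Conf n M) :
    ambientCoords f (alphaMap n f c) = confCoords n f.toFun c := by
  refine Prod.ext rfl (Prod.ext rfl (funext fun t => ?_))
  have h2 : f.toFun (c.1 (t.1 0)) - f.toFun (c.1 (t.1 2)) ≠ 0 :=
    sub_ne_zero.mpr fun e => c.apply_ne t (by decide) (f.injective e)
  simp only [ambientCoords, alphaMap, distRatio, Conf.map, confCoords, Function.comp]
  rw [ENNReal.toReal_inv, ENNReal.toReal_add (by simp) (ENNReal.div_ne_top (by simp) (by simpa)),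
    ENNReal.toReal_div]
  simp

theorem compactCoords_toCompactConf (c : Conf n M) :
    compactCoords f (toCompactConf n f c) = confCoords n f.toFun c :=
  ambientCoords_alphaMap f c

theorem ambientCoords_comp_alphaMap :
    (ambientCoords f ∘ alphaMap n f) = confCoords n f.toFun :=
  funext fun c => ambientCoords_alphaMap f c

theorem mem_compactConf_iff {a : AmbientSp n m M} :
    a ∈ compactConf n f ↔ ambientCoords f a ∈ closure (range (confCoords n f.toFun)) := by
  rw [compactConf, (isEmbedding_ambientCoords f).isInducing.closure_eq_preimage_closure_image,
    mem_preimage, ← range_comp, ambientCoords_comp_alphaMap]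

theorem compactCoords_mem_closure (x : compactConf n f) :
    compactCoords f x ∈ closure (range (confCoords n f.toFun)) :=
  (mem_compactConf_iff f).mp x.2

instance confNhds_compactCoords_neBot (x : compactConf n f) :
    (confNhds f.toFun (compactCoords f x)).NeBot :=
  confNhds_neBot.mpr (compactCoords_mem_closure f x)

theorem confNhds_compactCoords (x : compactConf n f) :
    confNhds f.toFun (compactCoords f x) = comap (alphaMap n f) (𝓝 x.1) := by
  rw [(isEmbedding_ambientCoords f).isInducing.nhds_eq_comap, comap_comap,
    ambientCoords_comp_alphaMap]
  rfl

/-- The sphere and the image of `[0,∞]` are closed, so the last two components of a limit are never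
lost. The image of `M` need not be closed, hence the hypothesis on base points. -/
theorem exists_compactCoords_eq {z : CoordSp n m}
    (hz : z ∈ closure (range (confCoords n f.toFun))) {p : Fin n → M}
    (hp : ∀ i, z.1 i = f.toFun (p i)) : ∃ x : compactConf n f, compactCoords f x = z := by
  have hs : ∀ q, z.2.1 q ∈ Metric.sphere (0 : EucSp m) 1 := fun q => by
    have hcl : IsClosed {v : CoordSp n m | v.2.1 q ∈ Metric.sphere (0 : EucSp m) 1} :=
      Metric.isClosed_sphere.preimage (by fun_prop)
    refine closure_minimal ?_ hcl hz
    rintro _ ⟨c, rfl⟩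
    rw [← ambientCoords_alphaMap]
    exact (unitDirection _ q).2
  have ht : ∀ t, ∃ s : ℝ≥0∞, ((1 + s)⁻¹).toReal = z.2.2 t := fun t => by
    have hcl : IsClosed {v : CoordSp n m | v.2.2 t ∈ range fun s : ℝ≥0∞ => ((1 + s)⁻¹).toReal} :=
      (isCompact_range continuous_toReal_inv_one_add).isClosed.preimage (by fun_prop)
    refine closure_minimal ?_ hcl hz
    rintro _ ⟨c, rfl⟩
    rw [← ambientCoords_alphaMap]
    exact mem_range_self _
  choose s hs' using ht
  let a : AmbientSp n m M := (p, fun q => ⟨z.2.1 q, hs q⟩, s)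
  have ha : ambientCoords f a = z :=
    Prod.ext (funext fun i => (hp i).symm) (Prod.ext rfl (funext hs'))
  exact ⟨⟨a, (mem_compactConf_iff f).mpr (ha ▸ hz)⟩, ha⟩

end Coordinates

/-! ### Continuous extension, its uniqueness and smoothness -/

section Extension

variable {n d m d' m' d'' m'' : ℕ} {M N P : Type*}
  [TopologicalSpace M] [ChartedSpace (EucSp d) M]
  [TopologicalSpace N] [ChartedSpace (EucSp d') N]
  [TopologicalSpace P] [ChartedSpace (EucSp d'') P]
  {f : EuclideanEmbedding d M m} {g : EuclideanEmbedding d' N m'}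
  {k : EuclideanEmbedding d'' P m''} {φ : M → N} {ψ : N → P}
  {hφ : Function.Injective φ} {hψ : Function.Injective ψ}
  {F : compactConf n f → compactConf n g}

/-- `F` extends by continuity the map induced by `φ` on configurations. -/
def ExtendsConfMap (f : EuclideanEmbedding d M m) (g : EuclideanEmbedding d' N m')
    (hφ : Function.Injective φ) (F : compactConf n f → compactConf n g) : Prop :=
  ∀ x, Tendsto (Conf.map φ hφ) (confNhds f.toFun (compactCoords f x))
    (confNhds g.toFun (compactCoords g (F x)))

theorem ExtendsConfMap.eq_of_tendsto (hF : ExtendsConfMap f g hφ F) {l : Filter (Conf n M)}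
    [l.NeBot] {x : compactConf n f} (hl : l ≤ confNhds f.toFun (compactCoords f x))
    {y : compactConf n g}
    (hy : Tendsto (Conf.map φ hφ) l (confNhds g.toFun (compactCoords g y))) : F x = y :=
  injective_compactCoords g (tendsto_nhds_unique
    (tendsto_confNhds.mp ((hF x).mono_left hl)) (tendsto_confNhds.mp hy))

/-- Source of all the functor and action identities: both sides extend the same map on
configurations. -/
theorem ExtendsConfMap.unique {φ' : M → N} {hφ' : Function.Injective φ'}
    {F' : compactConf n f → compactConf n g} (hF : ExtendsConfMap f g hφ F)
    (hF' : ExtendsConfMap f g hφ' F') (h : φ = φ') : F = F' := by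
  subst h
  exact funext fun x => hF.eq_of_tendsto le_rfl (hF' x)

theorem extendsConfMap_id : ExtendsConfMap (n := n) f f Function.injective_id id :=
  fun _ => tendsto_id

theorem ExtendsConfMap.comp {F' : compactConf n g → compactConf n k}
    (hF' : ExtendsConfMap g k hψ F') (hF : ExtendsConfMap f g hφ F) :
    ExtendsConfMap f k (hψ.comp hφ) (F' ∘ F) :=
  fun x => (hF' (F x)).comp (hF x)

theorem ExtendsConfMap.apply_toCompactConf (hF : ExtendsConfMap f g hφ F) (c : Conf n M) :
    F (toCompactConf n f c) = toCompactConf n g (c.map φ hφ) := by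
  -- The constant filter at `c` converges to the point of `c`, so the extension can be evaluated
  -- there.
  refine hF.eq_of_tendsto (l := pure c) ?_ ?_
  · rw [confNhds, ← map_le_iff_le_comap, map_pure, compactCoords_toCompactConf]
    exact pure_le_nhds _
  · rw [tendsto_confNhds, compactCoords_toCompactConf]
    exact tendsto_pure_left.mpr fun s hs => mem_of_mem_nhds hs

variable (S : SmoothVia f.toFun (g.toFun ∘ φ) id) (S' : SmoothVia (g.toFun ∘ φ) f.toFun id)

include S in
theorem ExtendsConfMap.base_apply (hF : ExtendsConfMap f g hφ F) (x : compactConf n f)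
    (i : Fin n) : (F x).1.1 i = φ (x.1.1 i) := by
  have h1 := tendsto_point (f := g.toFun) (hF x) i
  have h2 := S.tendsto (tendsto_point (f := f.toFun) (z := compactCoords f x) tendsto_id i)
  exact g.injective (tendsto_nhds_unique h1 h2)

include hφ S S' in
theorem exists_contDiffAt_compactCoords (x : compactConf n f) :
    ∃ G : CoordSp n m → CoordSp n m', ∀ᶠ v in 𝓝 (compactCoords f x), ContDiffAt ℝ ∞ G v ∧
      ∀ c, confCoords n f.toFun c = v → G v = confCoords n (g.toFun ∘ φ) c :=
  exists_contDiffAt_confCoords f.injective (g.injective.comp hφ) S S'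
    (compactCoords_mem_closure f x) fun _ => rfl

include S S' in
variable (n hφ) in
-- The smooth coordinate change is continuous, so the image configurations converge in coordinates.
-- Their limit comes from a point of `C_n[N]` because its base points are the images of those of `x`
-- under `φ`.
theorem exists_extendsConfMap :
    ∃ F : compactConf n f → compactConf n g, ExtendsConfMap f g hφ F := by
  suffices H : ∀ x : compactConf n f, ∃ y : compactConf n g, Tendsto (Conf.map φ hφ)
      (confNhds f.toFun (compactCoords f x)) (confNhds g.toFun (compactCoords g y)) from
    ⟨fun x => (H x).choose, fun x => (H x).choose_spec⟩
  intro x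
  obtain ⟨G, hG⟩ := exists_contDiffAt_compactCoords (hφ := hφ) S S' x
  have h1 : Tendsto (fun c => confCoords n g.toFun (c.map φ hφ))
      (confNhds f.toFun (compactCoords f x)) (𝓝 (G (compactCoords f x))) := by
    refine (hG.self_of_nhds.1.continuousAt.tendsto.comp (tendsto_confCoords _)).congr' ?_
    filter_upwards [(tendsto_confCoords _).eventually hG] with c hc
    exact hc.2 c rfl
  have h2 : G (compactCoords f x) ∈ closure (range (confCoords n g.toFun)) :=
    mem_closure_of_tendsto h1 (Eventually.of_forall fun c => mem_range_self _)
  obtain ⟨y, hy⟩ := exists_compactCoords_eq g h2 (p := fun i => φ (x.1.1 i)) fun i =>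
    tendsto_nhds_unique (tendsto_point (tendsto_confNhds.mpr h1) i)
      (S.tendsto (tendsto_point (f := f.toFun) (z := compactCoords f x) tendsto_id i))
  exact ⟨y, tendsto_confNhds.mpr (hy ▸ h1)⟩

include S S' in
-- The coordinate change with `f` and `g ∘ φ` exchanged is a smooth local left inverse; injectivity
-- follows from it.
theorem ExtendsConfMap.smoothEmbeddingVia (hF : ExtendsConfMap f g hφ F) :
    SmoothEmbeddingVia (compactCoords f) (compactCoords g) F := by
  have hinv : ∀ x : compactConf n f, ∃ G : CoordSp n m' → CoordSp n m,
      ∀ᶠ v in 𝓝 (compactCoords g (F x)), ContDiffAt ℝ ∞ G v ∧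
        ∀ y, compactCoords g (F y) = v → G v = compactCoords f y := by
    intro x
    have hz : compactCoords g (F x) ∈ closure (range (confCoords n (g.toFun ∘ φ))) :=
      mem_closure_of_tendsto (tendsto_confNhds.mp (hF x))
        (Eventually.of_forall fun c => mem_range_self _)
    obtain ⟨G, hG⟩ := exists_contDiffAt_confCoords (g.injective.comp hφ) f.injective S' S hz
      (p := x.1.1) fun i => congrArg g.toFun (hF.base_apply S x i)
    refine ⟨G, ?_⟩
    -- The identity for `G` is known at coordinates of configurations only. Holding throughout a
    -- neighbourhood of `v`, it passes to the limit along configurations tending to `y`.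
    filter_upwards [hG.eventually_nhds] with v hv
    refine ⟨hv.self_of_nhds.1, ?_⟩
    rintro y rfl
    have ht := tendsto_confNhds.mp (hF y)
    refine tendsto_nhds_unique (hv.self_of_nhds.1.continuousAt.tendsto.comp ht)
      ((tendsto_confCoords (f := f.toFun) (compactCoords f y)).congr' ?_)
    filter_upwards [ht.eventually hv] with c hc
    exact (hc.2 c rfl).symm
  refine ⟨fun x y hxy => ?_, smoothVia_iff_eventually.mpr fun x => ?_,
    smoothVia_iff_eventually.mpr hinv⟩
  · obtain ⟨G, hG⟩ := hinv x
    have h := hG.self_of_nhds.2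
    have e := h y (by rw [hxy])
    exact injective_compactCoords f ((h x rfl).symm.trans e)
  · obtain ⟨G, hG⟩ := exists_contDiffAt_compactCoords (hφ := hφ) S S' x
    refine ⟨G, ?_⟩
    filter_upwards [hG.eventually_nhds] with v hv
    refine ⟨hv.self_of_nhds.1, ?_⟩
    rintro y rfl
    have ht := tendsto_confNhds.mp (hF y)
    refine tendsto_nhds_unique (hv.self_of_nhds.1.continuousAt.tendsto.comp
      (tendsto_confCoords (f := f.toFun) (compactCoords f y))) (ht.congr' ?_)
    filter_upwards [(tendsto_confCoords _).eventually hv] with c hc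
    exact (hc.2 c rfl).symm

end Extension

/-! ### Local smooth left inverses of embeddings -/

section Retraction

variable {d d' m m' : ℕ} {M N : Type*}
  [TopologicalSpace M] [ChartedSpace (EucSp d) M]
  [TopologicalSpace N] [ChartedSpace (EucSp d') N]

variable (d d') in
/-- A map that has, near each point of its image, a smooth left inverse. -/
def HasSmoothRetractions (φ : M → N) : Prop :=
  ∀ p, ∃ π : N → M, ∀ᶠ y in 𝓝 (φ p), ContMDiffAt 𝓘(ℝ, EucSp d') 𝓘(ℝ, EucSp d) ∞ π y ∧
    ∀ q, φ q = y → π y = q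

theorem HasSmoothRetractions.injective {φ : M → N} (hφ : HasSmoothRetractions d d' φ) :
    Function.Injective φ := by
  intro p q hpq
  obtain ⟨π, hπ⟩ := hφ p
  have h := hπ.self_of_nhds.2
  rw [← h p rfl, h q hpq.symm]

/-- In suitable charts an immersion is `v ↦ (v, 0)`; the left inverse is the projection to the first
factor read in these charts. -/
theorem Manifold.IsSmoothEmbedding.hasSmoothRetractions
    {φ : M → N} (hφ : IsSmoothEmbedding 𝓘(ℝ, EucSp d) 𝓘(ℝ, EucSp d') ∞ φ) :
    HasSmoothRetractions d d' φ := by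
  intro p
  have him := hφ.isImmersion.isImmersionAt p
  let e₁ := him.domChart
  let e₂ := him.codChart
  let L := him.equiv.symm
  -- This uses the topological embedding: no distant part of `M` is mapped near `φ p`, so every
  -- preimage of `y` lies in the chart domain.
  have hsource : ∀ᶠ y in 𝓝 (φ p), ∀ q, φ q = y → q ∈ e₁.source := by
    have h1 : e₁.source ∈ comap φ (𝓝 (φ p)) := by
      rw [← hφ.isEmbedding.isInducing.nhds_eq_comap]
      exact e₁.open_source.mem_nhds him.mem_domChart_source
    obtain ⟨U, hU, hU'⟩ := h1
    filter_upwards [hU] with y hy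
    rintro q rfl
    exact hU' hy
  have hchart : ∀ q ∈ e₁.source, (L (e₂ (φ q))).1 = e₁ q := by
    intro q hq
    have hmem : e₁ q ∈ (him.domChart.extend 𝓘(ℝ, EucSp d)).target := by
      simpa using e₁.map_source hq
    have h1 := him.writtenInCharts hmem
    have h2 : e₂ (φ q) = him.equiv (e₁ q, 0) := by
      simpa [e₁.left_inv hq, e₁, e₂] using h1
    rw [h2]
    simp [L]
  have h2 : e₂.source ∈ 𝓝 (φ p) := e₂.open_source.mem_nhds him.mem_codChart_source
  have hcont : ContinuousAt (fun y => (L (e₂ y)).1) (φ p) :=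
    continuous_fst.continuousAt.comp
      (L.continuous.continuousAt.comp (e₂.continuousAt him.mem_codChart_source))
  have htarget : ∀ᶠ y in 𝓝 (φ p), (L (e₂ y)).1 ∈ e₁.target := by
    refine hcont.eventually (e₁.open_target.mem_nhds ?_)
    simp only [hchart p him.mem_domChart_source]
    exact e₁.map_source him.mem_domChart_source
  refine ⟨fun y => e₁.symm (L (e₂ y)).1, ?_⟩
  filter_upwards [hsource, h2, htarget] with y hy hy2 hyt
  constructor
  · have c1 : ContMDiffAt 𝓘(ℝ, EucSp d') 𝓘(ℝ, EucSp d') ∞ e₂ y :=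
      contMDiffAt_of_mem_maximalAtlas him.codChart_mem_maximalAtlas hy2
    have c2 : ContMDiffAt 𝓘(ℝ, EucSp d) 𝓘(ℝ, EucSp d) ∞ e₁.symm (L (e₂ y)).1 :=
      contMDiffAt_symm_of_mem_maximalAtlas him.domChart_mem_maximalAtlas hyt
    have c3 : ContMDiff 𝓘(ℝ, EucSp d') 𝓘(ℝ, EucSp d) ∞ fun v : EucSp d' => (L v).1 :=
      (contDiff_fst.comp L.contDiff).contMDiff
    exact c2.comp y (c3.contMDiffAt.comp y c1)
  · rintro q rfl
    have hq := hy q rfl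
    simp only [hchart q hq, e₁.left_inv hq]

theorem Diffeomorph.hasSmoothRetractions
    (φ : M ≃ₘ^∞⟮𝓘(ℝ, EucSp d), 𝓘(ℝ, EucSp d')⟯ N) : HasSmoothRetractions d d' φ := fun _ =>
  ⟨φ.symm, Eventually.of_forall fun _ =>
    ⟨φ.symm.contMDiff.contMDiffAt, fun q hq => hq ▸ φ.symm_apply_apply q⟩⟩

theorem EuclideanEmbedding.hasSmoothRetractions (f : EuclideanEmbedding d M m) :
    HasSmoothRetractions d m f.toFun :=
  f.isSmoothEmbedding.hasSmoothRetractions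

theorem EuclideanEmbedding.contMDiff (f : EuclideanEmbedding d M m) :
    ContMDiff 𝓘(ℝ, EucSp d) 𝓘(ℝ, EucSp m) ∞ f.toFun :=
  f.isSmoothEmbedding.contMDiff

theorem EuclideanEmbedding.smoothVia_of_contMDiff (f : EuclideanEmbedding d M m)
    {h : M → EucSp m'} (hh : ContMDiff 𝓘(ℝ, EucSp d) 𝓘(ℝ, EucSp m') ∞ h) :
    SmoothVia f.toFun h id := by
  rw [smoothVia_iff_eventually]
  intro p
  obtain ⟨π, hπ⟩ := f.hasSmoothRetractions p
  refine ⟨h ∘ π, hπ.mono fun y hy => ⟨?_, fun q hq => ?_⟩⟩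
  · exact (hh.contMDiffAt.comp y hy.1).contDiffAt
  · simp only [Function.comp, hy.2 q hq, id]

theorem EuclideanEmbedding.smoothVia_of_hasSmoothRetractions (f : EuclideanEmbedding d M m)
    (g : EuclideanEmbedding d' N m') {φ : M → N} (hφ : HasSmoothRetractions d d' φ) :
    SmoothVia (g.toFun ∘ φ) f.toFun id := by
  rw [smoothVia_iff_eventually]
  intro p
  obtain ⟨π, hπ⟩ := hφ p
  obtain ⟨ρ, hρ⟩ := g.hasSmoothRetractions (φ p)
  have h0 := hρ.self_of_nhds
  have hc : Tendsto ρ (𝓝 (g.toFun (φ p))) (𝓝 (φ p)) := by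
    have := h0.1.continuousAt.tendsto
    rwa [h0.2 _ rfl] at this
  refine ⟨f.toFun ∘ π ∘ ρ, ?_⟩
  filter_upwards [hρ, hc.eventually hπ] with y hy hy'
  refine ⟨?_, fun q hq => ?_⟩
  · exact ((f.contMDiff.contMDiffAt.comp _ hy'.1).comp y hy.1).contDiffAt
  · have e := hy.2 (φ q) hq
    simp only [Function.comp, id]
    rw [hy'.2 q e.symm]

theorem HasSmoothRetractions.mfderiv_injective {φ : M → N} (hφ : HasSmoothRetractions d d' φ)
    (hφ' : ContMDiff 𝓘(ℝ, EucSp d) 𝓘(ℝ, EucSp d') ∞ φ) (p : M) :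
    Function.Injective (mfderiv 𝓘(ℝ, EucSp d) 𝓘(ℝ, EucSp d') φ p) := by
  obtain ⟨π, hπ⟩ := hφ p
  have h1 : (π ∘ φ) =ᶠ[𝓝 p] id :=
    (hφ'.continuous.continuousAt.tendsto.eventually hπ).mono fun q hq => hq.2 q rfl
  have h2 := mfderiv_comp p (hπ.self_of_nhds.1.mdifferentiableAt (by simp))
    (hφ'.contMDiffAt.mdifferentiableAt (by simp))
  rw [h1.mfderiv_eq, mfderiv_id] at h2
  intro v w hvw
  have h3 : ∀ u, u = mfderiv 𝓘(ℝ, EucSp d') 𝓘(ℝ, EucSp d) π (φ p)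
      (mfderiv 𝓘(ℝ, EucSp d) 𝓘(ℝ, EucSp d') φ p u) := fun u => DFunLike.congr_fun h2 u
  rw [h3 v, h3 w, hvw]

end Retraction

/-! ### Ratio coordinates as asymptotic relations -/

section Ratio

open Asymptotics

variable {n d m : ℕ} {M : Type*} [TopologicalSpace M] [ChartedSpace (EucSp d) M]
  {f : EuclideanEmbedding d M m} {x : compactConf n f} {l : Filter (Conf n M)}

theorem EuclideanEmbedding.sub_ne_zero_of_ne (f : EuclideanEmbedding d M m) (c : Conf n M)
    {i j : Fin n} (hij : i ≠ j) : f.toFun (c.1 i) - f.toFun (c.1 j) ≠ 0 :=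
  sub_ne_zero.mpr fun e => hij (c.2 (f.injective e))

theorem Conf.index_ne {k : ℕ} {Y : Type*} (q : Conf k Y) {a b : Fin k} (h : a ≠ b) :
    q.1 a ≠ q.1 b := fun e => h (q.2 e)

theorem tendsto_coord (hl : l ≤ confNhds f.toFun (compactCoords f x)) (i : Fin n) :
    Tendsto (fun c : Conf n M => f.toFun (c.1 i)) l (𝓝 (f.toFun (x.1.1 i))) :=
  tendsto_point (u := id) hl i

theorem tendsto_unitDirection (hl : l ≤ confNhds f.toFun (compactCoords f x))
    (q : Conf 2 (Fin n)) :
    Tendsto (fun c : Conf n M => ‖f.toFun (c.1 (q.1 0)) - f.toFun (c.1 (q.1 1))‖⁻¹ •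
      (f.toFun (c.1 (q.1 0)) - f.toFun (c.1 (q.1 1)))) l (𝓝 (x.1.2.1 q : EucSp m)) :=
  tendsto_direction (u := id) hl q

theorem tendsto_ratio (hl : l ≤ confNhds f.toFun (compactCoords f x)) (t : Conf 3 (Fin n)) :
    Tendsto (fun c : Conf n M => ‖f.toFun (c.1 (t.1 0)) - f.toFun (c.1 (t.1 1))‖ₑ /
      ‖f.toFun (c.1 (t.1 0)) - f.toFun (c.1 (t.1 2))‖ₑ) l (𝓝 (x.1.2.2 t)) := by
  rw [confNhds_compactCoords] at hl
  have h1 : Tendsto (alphaMap n f) l (𝓝 x.1) := tendsto_comap.mono_left hl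
  exact ((continuous_apply t).comp continuous_snd.snd).tendsto x.1 |>.comp h1

theorem enorm_div_enorm {E : Type*} [NormedAddCommGroup E] {a b : E} (hb : b ≠ 0) :
    ‖a‖ₑ / ‖b‖ₑ = ENNReal.ofReal (‖a‖ / ‖b‖) := by
  rw [ENNReal.ofReal_div_of_pos (norm_pos_iff.mpr hb), ofReal_norm, ofReal_norm]

theorem ratio_eq_ofReal_iff [l.NeBot] (hl : l ≤ confNhds f.toFun (compactCoords f x))
    (t : Conf 3 (Fin n)) {r : ℝ} (hr : 0 ≤ r) :
    x.1.2.2 t = ENNReal.ofReal r ↔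
      Tendsto (fun c : Conf n M => ‖f.toFun (c.1 (t.1 0)) - f.toFun (c.1 (t.1 1))‖ /
        ‖f.toFun (c.1 (t.1 0)) - f.toFun (c.1 (t.1 2))‖) l (𝓝 r) := by
  have h1 := tendsto_ratio hl t
  have hne : ∀ c : Conf n M, f.toFun (c.1 (t.1 0)) - f.toFun (c.1 (t.1 2)) ≠ 0 := fun c =>
    f.sub_ne_zero_of_ne c (t.index_ne (by decide))
  constructor
  · intro h
    rw [h] at h1
    have h2 := (ENNReal.tendsto_toReal ENNReal.ofReal_ne_top).comp h1
    rw [ENNReal.toReal_ofReal hr] at h2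
    refine h2.congr fun c => ?_
    simp [ENNReal.toReal_div]
  · intro h
    refine tendsto_nhds_unique h1 ((ENNReal.tendsto_ofReal h).congr fun c => ?_)
    exact (enorm_div_enorm (hne c)).symm

theorem ratio_eq_zero_iff [l.NeBot] (hl : l ≤ confNhds f.toFun (compactCoords f x))
    (t : Conf 3 (Fin n)) :
    x.1.2.2 t = 0 ↔ (fun c : Conf n M => f.toFun (c.1 (t.1 0)) - f.toFun (c.1 (t.1 1)))
      =o[l] fun c => f.toFun (c.1 (t.1 0)) - f.toFun (c.1 (t.1 2)) := by
  rw [← isLittleO_norm_norm, isLittleO_iff_tendsto, ← ratio_eq_ofReal_iff hl t le_rfl,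
    ENNReal.ofReal_zero]
  intro c hc
  exact absurd (norm_eq_zero.mp hc) (f.sub_ne_zero_of_ne c (t.index_ne (by decide)))

/-- Exchange of the last two indices of a triple. -/
def Conf.swapLast {Y : Type*} (t : Conf 3 Y) : Conf 3 Y :=
  ⟨t.1 ∘ ![0, 2, 1], t.2.comp (by decide)⟩

theorem ratio_swapLast [l.NeBot] (hl : l ≤ confNhds f.toFun (compactCoords f x))
    (t : Conf 3 (Fin n)) : x.1.2.2 t.swapLast = (x.1.2.2 t)⁻¹ := by
  refine tendsto_nhds_unique (tendsto_ratio hl t.swapLast)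
    ((tendsto_ratio hl t).inv.congr fun c => ?_)
  rw [ENNReal.inv_div (by simp) (Or.inr ?_)]
  · rfl
  · simpa using f.sub_ne_zero_of_ne c (t.index_ne (a := 0) (b := 1) (by decide))

theorem ratio_eq_top_iff [l.NeBot] (hl : l ≤ confNhds f.toFun (compactCoords f x))
    (t : Conf 3 (Fin n)) :
    x.1.2.2 t = ⊤ ↔ (fun c : Conf n M => f.toFun (c.1 (t.1 0)) - f.toFun (c.1 (t.1 2)))
      =o[l] fun c => f.toFun (c.1 (t.1 0)) - f.toFun (c.1 (t.1 1)) := by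
  rw [← ENNReal.inv_eq_zero, ← ratio_swapLast hl t]
  exact ratio_eq_zero_iff hl t.swapLast

theorem excludes_iff [l.NeBot] (hl : l ≤ confNhds f.toFun (compactCoords f x)) (i j k : Fin n) :
    Excludes x.1 i j k ↔ i ≠ j ∧ (fun c : Conf n M => f.toFun (c.1 i) - f.toFun (c.1 j))
      =o[l] fun c => f.toFun (c.1 i) - f.toFun (c.1 k) := by
  constructor
  · rintro ⟨h, h0⟩
    exact ⟨fun e => absurd (h (a₁ := 0) (a₂ := 1) e) (by decide), (ratio_eq_zero_iff hl _).mp h0⟩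
  · rintro ⟨hij, ho⟩
    -- Distinctness of the three indices is automatic: a nowhere vanishing difference is neither
    -- little-o of itself nor of zero.
    have hjk : j ≠ k := by
      rintro rfl
      exact isLittleO_irrefl (Frequently.of_forall fun c => f.sub_ne_zero_of_ne c hij) ho
    have hik : i ≠ k := by
      rintro rfl
      simp only [sub_self, isLittleO_zero_right_iff] at ho
      obtain ⟨c, hc⟩ := ho.exists
      exact f.sub_ne_zero_of_ne c hij hc
    have h : Function.Injective ![i, j, k] := by
      intro a b hab
      fin_cases a <;> fin_cases b <;> simp_all
    exact ⟨h, (ratio_eq_zero_iff hl ⟨_, h⟩).mpr ho⟩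

end Ratio

/-! ### Invariance of the tree -/

section Tree

open Asymptotics

variable {n d m d' m' : ℕ} {M N : Type*}
  [TopologicalSpace M] [ChartedSpace (EucSp d) M]
  [TopologicalSpace N] [ChartedSpace (EucSp d') N]
  {f : EuclideanEmbedding d M m} {g : EuclideanEmbedding d' N m'} {φ : M → N}
  {hφ : Function.Injective φ} {F : compactConf n f → compactConf n g}
  (S : SmoothVia f.toFun (g.toFun ∘ φ) id) (S' : SmoothVia (g.toFun ∘ φ) f.toFun id)

include hφ S S' in
-- Lipschitz bounds in both directions. Little-o relations between differences therefore do not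
-- depend on the embedding.
theorem isTheta_sub (x : compactConf n f) (i j : Fin n) :
    (fun c : Conf n M => g.toFun (φ (c.1 i)) - g.toFun (φ (c.1 j)))
      =Θ[confNhds f.toFun (compactCoords f x)] fun c => f.toFun (c.1 i) - f.toFun (c.1 j) := by
  have h := tendsto_coord (x := x) le_rfl
  exact ⟨S.isBigO_sub f.injective (h i) (h j),
    S'.isBigO_sub (g.injective.comp hφ) (S.tendsto (h i)) (S.tendsto (h j))⟩

theorem ExtendsConfMap.map_le (hF : ExtendsConfMap f g hφ F) (x : compactConf n f) :
    map (Conf.map φ hφ) (confNhds f.toFun (compactCoords f x)) ≤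
      confNhds g.toFun (compactCoords g (F x)) := hF x

include S S' in
theorem ExtendsConfMap.excludes_iff (hF : ExtendsConfMap f g hφ F) (x : compactConf n f)
    (i j k : Fin n) : Excludes (F x).1 i j k ↔ Excludes x.1 i j k := by
  rw [_root_.excludes_iff (hF.map_le x), _root_.excludes_iff (x := x) le_rfl, isLittleO_map]
  have h1 := isTheta_sub (hφ := hφ) S S' x i j
  have h2 := isTheta_sub (hφ := hφ) S S' x i k
  exact and_congr_right fun _ => (h1.isLittleO_congr_left).trans h2.isLittleO_congr_right

include S S' in
theorem ExtendsConfMap.treeOf_eq (hF : ExtendsConfMap f g hφ F) (x : compactConf n f) :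
    treeOf (F x).1 = treeOf x.1 := by
  simp only [treeOf, hF.excludes_iff S S', hF.base_apply S, hφ.eq_iff]

end Tree

/-! ### The differential on infinitesimal configurations -/

section InfinitesimalTransport

open Asymptotics

theorem norm_inv_smul_smul_of_pos {E : Type*} [NormedAddCommGroup E] [NormedSpace ℝ E] {r : ℝ}
    (hr : 0 < r) (v : E) : ‖r • v‖⁻¹ • (r • v) = ‖v‖⁻¹ • v := by
  rw [norm_smul, Real.norm_of_nonneg hr.le, smul_smul, mul_inv, mul_right_comm,
    inv_mul_cancel₀ hr.ne', one_mul]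

theorem Filter.Tendsto.normalize {ι E : Type*} [NormedAddCommGroup E] [NormedSpace ℝ E]
    {l : Filter ι} {u : ι → E} {v : E} (hu : Tendsto u l (𝓝 v)) (hv : v ≠ 0) :
    Tendsto (fun a => ‖u a‖⁻¹ • u a) l (𝓝 (‖v‖⁻¹ • v)) :=
  (hu.norm.inv₀ (norm_ne_zero_iff.mpr hv)).smul hu

variable {n d m d' m' : ℕ} {M N : Type*}
  [TopologicalSpace M] [ChartedSpace (EucSp d) M]
  [TopologicalSpace N] [ChartedSpace (EucSp d') N]
  {f : EuclideanEmbedding d M m} {g : EuclideanEmbedding d' N m'} {φ : M → N}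
  {hφ : Function.Injective φ} {F : compactConf n f → compactConf n g}

theorem EuclideanEmbedding.push_sub (f : EuclideanEmbedding d M m) (p : M)
    (v w : TangentSpace 𝓘(ℝ, EucSp d) p) : f.push p (v - w) = f.push p v - f.push p w :=
  map_sub (mfderiv 𝓘(ℝ, EucSp d) 𝓘(ℝ, EucSp m) f.toFun p) v w

@[simp]
theorem EuclideanEmbedding.push_zero (f : EuclideanEmbedding d M m) (p : M) : f.push p 0 = 0 :=
  map_zero (mfderiv 𝓘(ℝ, EucSp d) 𝓘(ℝ, EucSp m) f.toFun p)

theorem EuclideanEmbedding.push_injective (f : EuclideanEmbedding d M m) (p : M) :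
    Function.Injective (f.push p) :=
  f.hasSmoothRetractions.mfderiv_injective f.contMDiff p

theorem EuclideanEmbedding.push_ne_zero (f : EuclideanEmbedding d M m) (p : M)
    {v w : TangentSpace 𝓘(ℝ, EucSp d) p} (h : v ≠ w) : f.push p (v - w) ≠ 0 := by
  rw [f.push_sub]
  exact sub_ne_zero.mpr fun e => h (f.push_injective p e)

theorem fderiv_push_of_eventually (hφs : ContMDiff 𝓘(ℝ, EucSp d) 𝓘(ℝ, EucSp d') ∞ φ)
    {G : EucSp m → EucSp m'} {p : M} (hG : DifferentiableAt ℝ G (f.toFun p))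
    (h : ∀ᶠ q in 𝓝 p, G (f.toFun q) = g.toFun (φ q)) (v : TangentSpace 𝓘(ℝ, EucSp d) p) :
    fderiv ℝ G (f.toFun p) (f.push p v) =
      g.push (φ p) (mfderiv 𝓘(ℝ, EucSp d) 𝓘(ℝ, EucSp d') φ p v) := by
  have h1 := mfderiv_comp p hG.mdifferentiableAt
    (f.contMDiff.contMDiffAt.mdifferentiableAt (x := p) (by simp))
  have h2 := mfderiv_comp p (g.contMDiff.contMDiffAt.mdifferentiableAt (x := φ p) (by simp))
    (hφs.contMDiffAt.mdifferentiableAt (x := p) (by simp))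
  have h3 : G ∘ f.toFun =ᶠ[𝓝 p] g.toFun ∘ φ := h
  rw [h3.mfderiv_eq, h2, mfderiv_eq_fderiv] at h1
  exact (DFunLike.congr_fun h1 v).symm

/-- If `g ∘ φ = G ∘ f` near `p`, strict differentiability makes the secant tend to `DG(u_ij)`, and
`DG ∘ Df = Dg ∘ Dφ` on tangent vectors. -/
theorem tendsto_secant (S : SmoothVia f.toFun (g.toFun ∘ φ) id)
    (hφs : ContMDiff 𝓘(ℝ, EucSp d) 𝓘(ℝ, EucSp d') ∞ φ) (x : compactConf n f)
    (q : Conf 2 (Fin n)) {p : M} (h0 : x.1.1 (q.1 0) = p) (h1 : x.1.1 (q.1 1) = p)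
    {v : TangentSpace 𝓘(ℝ, EucSp d) p}
    (hv : (x.1.2.1 q : EucSp m) = ‖f.push p v‖⁻¹ • f.push p v) :
    Tendsto (fun c : Conf n M => ‖f.toFun (c.1 (q.1 0)) - f.toFun (c.1 (q.1 1))‖⁻¹ •
        (g.toFun (φ (c.1 (q.1 0))) - g.toFun (φ (c.1 (q.1 1)))))
      (confNhds f.toFun (compactCoords f x))
      (𝓝 (‖f.push p v‖⁻¹ • g.push (φ p) (mfderiv 𝓘(ℝ, EucSp d) 𝓘(ℝ, EucSp d') φ p v))) := by
  obtain ⟨G, hG⟩ := smoothVia_iff_eventually.mp S p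
  have hGd := hG.self_of_nhds.1.hasStrictFDerivAt (n := ∞) (by simp)
  have hGf : ∀ᶠ q in 𝓝 p, G (f.toFun q) = g.toFun (φ q) :=
    (f.contMDiff.continuous.continuousAt.tendsto.eventually hG).mono fun q hq => hq.2 q rfl
  have t0 : Tendsto (fun c : Conf n M => f.toFun (c.1 (q.1 0)))
      (confNhds f.toFun (compactCoords f x)) (𝓝 (f.toFun p)) := h0 ▸ tendsto_coord le_rfl _
  have t1 : Tendsto (fun c : Conf n M => f.toFun (c.1 (q.1 1)))
      (confNhds f.toFun (compactCoords f x)) (𝓝 (f.toFun p)) := h1 ▸ tendsto_coord le_rfl _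
  have e1 := ((hGd.isLittleO.comp_tendsto (t0.prodMk_nhds t1)).norm_right).tendsto_inv_smul_nhds_zero
  have e2 := ((fderiv ℝ G (f.toFun p)).continuous.tendsto _).comp
    (tendsto_unitDirection (x := x) le_rfl q)
  have e3 := e1.add e2
  rw [hv, map_smul, fderiv_push_of_eventually hφs hGd.differentiableAt hGf, zero_add] at e3
  refine e3.congr' ?_
  filter_upwards [t0.eventually hG, t1.eventually hG] with c hc0 hc1
  have a0 := hc0.2 _ rfl
  have a1 := hc1.2 _ rfl
  simp only [Function.comp, id] at a0 a1
  simp only [Function.comp, a0, a1, map_smul, ← smul_add, sub_add_cancel]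

theorem ExtendsConfMap.isInfinitesimalConf (hF : ExtendsConfMap f g hφ F)
    (S : SmoothVia f.toFun (g.toFun ∘ φ) id) (S' : SmoothVia (g.toFun ∘ φ) f.toFun id)
    (hφs : ContMDiff 𝓘(ℝ, EucSp d) 𝓘(ℝ, EucSp d') ∞ φ)
    (hφr : HasSmoothRetractions d d' φ) {x : compactConf n f} {A : Set (Fin n)} {p : M}
    {y : Fin n → TangentSpace 𝓘(ℝ, EucSp d) p} (h : IsInfinitesimalConf f x.1 A p y) :
    IsInfinitesimalConf g (F x).1 A (φ p)
      (fun i => mfderiv 𝓘(ℝ, EucSp d) 𝓘(ℝ, EucSp d') φ p (y i)) := by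
  have hinj := hφr.mfderiv_injective hφs p
  have hdir : ∀ q : Conf 2 (Fin n), (∀ a, q.1 a ∈ A) → y (q.1 0) ≠ y (q.1 1) →
      Tendsto (fun c : Conf n M => ‖f.toFun (c.1 (q.1 0)) - f.toFun (c.1 (q.1 1))‖⁻¹ •
        (g.toFun (φ (c.1 (q.1 0))) - g.toFun (φ (c.1 (q.1 1)))))
      (confNhds f.toFun (compactCoords f x))
      (𝓝 (‖f.push p (y (q.1 0) - y (q.1 1))‖⁻¹ • g.push (φ p)
        (mfderiv 𝓘(ℝ, EucSp d) 𝓘(ℝ, EucSp d') φ p (y (q.1 0)) -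
          mfderiv 𝓘(ℝ, EucSp d) 𝓘(ℝ, EucSp d') φ p (y (q.1 1))))) := fun q hq hne => by
    have := tendsto_secant (g := g) S hφs x q (h.base _ (hq 0)) (h.base _ (hq 1))
      (h.direction q hq hne)
    rwa [map_sub] at this
  refine ⟨fun i hi => ?_, fun i hi j hj => ?_, fun q hq hne => ?_, fun t ht hne => ?_⟩
  · rw [hF.base_apply S, h.base i hi]
  · rw [hF.treeOf_eq S S', ← h.distinct i hi j hj]
    exact hinj.eq_iff
  · have hne' : y (q.1 0) ≠ y (q.1 1) := fun e => hne (by simp only [e])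
    have hf0 : 0 < ‖f.push p (y (q.1 0) - y (q.1 1))‖⁻¹ :=
      inv_pos.mpr (norm_pos_iff.mpr (f.push_ne_zero p hne'))
    have h1 := (hdir q hq hne').normalize
      (smul_ne_zero hf0.ne' (g.push_ne_zero (φ p) hne))
    rw [norm_inv_smul_smul_of_pos hf0] at h1
    have h2 := tendsto_map'_iff.mp (tendsto_unitDirection (hF.map_le x) q)
    refine tendsto_nhds_unique h2 (h1.congr fun c => ?_)
    exact norm_inv_smul_smul_of_pos (inv_pos.mpr (norm_pos_iff.mpr
      (f.sub_ne_zero_of_ne c (q.index_ne (by decide))))) _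
  · have hne' : ¬ (y (t.1 0) = y (t.1 1) ∧ y (t.1 0) = y (t.1 2)) := fun e =>
      hne ⟨congrArg _ e.1, congrArg _ e.2⟩
    have hr := h.ratio t ht hne'
    have θ := fun i j => isTheta_sub (hφ := hφ) S S' x i j
    -- If one of the two differences vanishes, the ratio is `0` or `∞`, a little-o relation
    -- preserved by `isTheta_sub`. Otherwise the new ratio is the old one times a quotient of limits
    -- of secants.
    by_cases h01 : y (t.1 0) = y (t.1 1)
    · have h02 : y (t.1 0) ≠ y (t.1 2) := fun e => hne' ⟨h01, e⟩
      have z0 : x.1.2.2 t = 0 := by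
        rw [hr, h01, sub_self, f.push_zero]; simp
      rw [ratio_eq_zero_iff (x := x) le_rfl] at z0
      have z1 : (F x).1.2.2 t = 0 := by
        rw [ratio_eq_zero_iff (hF.map_le x), isLittleO_map]
        exact ((θ _ _).isLittleO_congr_left.trans (θ _ _).isLittleO_congr_right).mpr z0
      rw [z1, h01, sub_self, g.push_zero]; simp
    · have hdne : mfderiv 𝓘(ℝ, EucSp d) 𝓘(ℝ, EucSp d') φ p (y (t.1 0)) ≠
          mfderiv 𝓘(ℝ, EucSp d) 𝓘(ℝ, EucSp d') φ p (y (t.1 1)) := fun e => h01 (hinj e)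
      by_cases h02 : y (t.1 0) = y (t.1 2)
      · have z0 : x.1.2.2 t = ⊤ := by
          rw [hr, ← h02, sub_self, f.push_zero, enorm_zero, ENNReal.div_zero]
          simpa using f.push_ne_zero p h01
        rw [ratio_eq_top_iff (x := x) le_rfl] at z0
        have z1 : (F x).1.2.2 t = ⊤ := by
          rw [ratio_eq_top_iff (hF.map_le x), isLittleO_map]
          exact ((θ _ _).isLittleO_congr_left.trans (θ _ _).isLittleO_congr_right).mpr z0
        rw [z1, ← h02, sub_self, g.push_zero, enorm_zero, ENNReal.div_zero]
        simpa using g.push_ne_zero (φ p) hdne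
      · have hdne2 : mfderiv 𝓘(ℝ, EucSp d) 𝓘(ℝ, EucSp d') φ p (y (t.1 0)) ≠
          mfderiv 𝓘(ℝ, EucSp d) 𝓘(ℝ, EucSp d') φ p (y (t.1 2)) := fun e => h02 (hinj e)
        have s1 := (hdir t.pair₁ (fun a => ht _) h01).norm
        have s2 := (hdir t.pair₂ (fun a => ht _) h02).norm
        simp only [Conf.pair₁, Conf.pair₂, Function.comp, Matrix.cons_val_zero,
          Matrix.cons_val_one, norm_smul, norm_inv, norm_norm] at s1 s2
        have p1 := norm_pos_iff.mpr (f.push_ne_zero p h01)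
        have p2 := norm_pos_iff.mpr (f.push_ne_zero p h02)
        have p3 := norm_pos_iff.mpr (g.push_ne_zero (φ p) hdne)
        have p4 := norm_pos_iff.mpr (g.push_ne_zero (φ p) hdne2)
        rw [enorm_div_enorm (norm_pos_iff.mp p2),
          ratio_eq_ofReal_iff (x := x) le_rfl t (by positivity)] at hr
        rw [enorm_div_enorm (norm_pos_iff.mp p4), ratio_eq_ofReal_iff (hF.map_le x) t (by positivity),
          tendsto_map'_iff]
        have s3 := (s1.div s2 (by positivity)).mul hr
        convert! s3.congr fun c => ?_ using 2
        · field_simp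
        · have q1 := norm_pos_iff.mpr
            (f.sub_ne_zero_of_ne c (t.index_ne (a := 0) (b := 1) (by decide)))
          have q2 := norm_pos_iff.mpr
            (f.sub_ne_zero_of_ne c (t.index_ne (a := 0) (b := 2) (by decide)))
          have q4 := norm_pos_iff.mpr
            (g.sub_ne_zero_of_ne (c.map φ hφ) (t.index_ne (a := 0) (b := 2) (by decide)))
          simp only [Conf.map, Function.comp, Pi.div_apply] at q4 ⊢
          field_simp

end InfinitesimalTransport

/-! ### Existence of infinitesimal configurations -/

section InfinitesimalExistence

open Asymptotics

/-- For an ultrafilter, failure of `|u| ≤ ε |v|` eventually means `|u| > ε |v|` eventually. Any two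
differences thus become comparable in order of magnitude. -/
theorem Ultrafilter.isBigO_of_not_isLittleO {ι E E' : Type*} [NormedAddCommGroup E]
    [NormedAddCommGroup E'] {l : Ultrafilter ι} {u : ι → E} {v : ι → E'}
    (h : ¬ u =o[(l : Filter ι)] v) : v =O[(l : Filter ι)] u := by
  simp only [isLittleO_iff, not_forall] at h
  obtain ⟨ε, hε, h⟩ := h
  refine IsBigO.of_bound ε⁻¹ ?_
  filter_upwards [Ultrafilter.eventually_not.mpr h] with a ha
  rw [inv_mul_eq_div, le_div_iff₀ hε, mul_comm]
  exact (not_le.mp ha).le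

variable {n d m : ℕ} {M : Type*} [TopologicalSpace M] [ChartedSpace (EucSp d) M]

/-- A limit of rescaled secants is tangent: `f ∘ π` fixes the image of `f`, so its derivative at
`f(p)` fixes `Y`, and this derivative factors through `Df`. -/
theorem EuclideanEmbedding.exists_push_eq (f : EuclideanEmbedding d M m) {ι : Type*}
    {l : Filter ι} [l.NeBot] {u v : ι → M} {p : M} {r : ι → ℝ} {Y : EucSp m}
    (hu : Tendsto (fun a => f.toFun (u a)) l (𝓝 (f.toFun p)))
    (hv : Tendsto (fun a => f.toFun (v a)) l (𝓝 (f.toFun p)))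
    (hY : Tendsto (fun a => r a • (f.toFun (u a) - f.toFun (v a))) l (𝓝 Y)) :
    ∃ w : TangentSpace 𝓘(ℝ, EucSp d) p, f.push p w = Y := by
  obtain ⟨π, hπ⟩ := f.hasSmoothRetractions p
  have hπp : π (f.toFun p) = p := hπ.self_of_nhds.2 p rfl
  have hπd := hπ.self_of_nhds.1
  have hP : ContDiffAt ℝ ∞ (f.toFun ∘ π) (f.toFun p) :=
    (f.contMDiff.contMDiffAt.comp _ hπd).contDiffAt
  have e1 := (hP.hasStrictFDerivAt (by simp)).isLittleO.comp_tendsto (hu.prodMk_nhds hv)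
  have e2 := ((isBigO_refl r l).smul_isLittleO e1).trans_isBigO (hY.isBigO_one ℝ)
  rw [isLittleO_one_iff] at e2
  have e3 := hY.sub (((fderiv ℝ (f.toFun ∘ π) (f.toFun p)).continuous.tendsto _).comp hY)
  have e4 : Y - fderiv ℝ (f.toFun ∘ π) (f.toFun p) Y = 0 := by
    refine tendsto_nhds_unique (e3.congr' ?_) e2
    filter_upwards [hu.eventually hπ, hv.eventually hπ] with a ha ha'
    simp only [Function.comp, ha.2 _ rfl, ha'.2 _ rfl, map_smul]
    exact (smul_sub _ _ _).symm
  have e5 := mfderiv_comp (f.toFun p)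
    (f.contMDiff.contMDiffAt.mdifferentiableAt (x := π (f.toFun p)) (by simp))
    (hπd.mdifferentiableAt (by simp))
  rw [mfderiv_eq_fderiv] at e5
  -- The vector obtained lives at `π (f p)`, equal to `p` only propositionally; quantifying over `q
  -- = p` moves it to the tangent space at `p`.
  have key : ∃ q, q = p ∧ ∃ w : TangentSpace 𝓘(ℝ, EucSp d) q, f.push q w = Y := by
    refine ⟨π (f.toFun p), hπp, mfderiv 𝓘(ℝ, EucSp m) 𝓘(ℝ, EucSp d) π (f.toFun p) Y, ?_⟩
    exact (DFunLike.congr_fun e5 Y).symm.trans (sub_eq_zero.mp e4).symm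
  obtain ⟨q, rfl, w, hw⟩ := key
  exact ⟨w, hw⟩

variable {f : EuclideanEmbedding d M m} {x : compactConf n f}

theorem base_eq_of_isLittleO {l : Filter (Conf n M)} [l.NeBot]
    (hl : l ≤ confNhds f.toFun (compactCoords f x)) {a b e : Fin n}
    (h : (fun c : Conf n M => f.toFun (c.1 a) - f.toFun (c.1 b))
      =o[l] fun c => f.toFun (c.1 a) - f.toFun (c.1 e)) : x.1.1 a = x.1.1 b := by
  have h1 := h.trans_isBigO (((tendsto_coord hl a).sub (tendsto_coord hl e)).isBigO_one ℝ)
  rw [isLittleO_one_iff] at h1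
  exact f.injective (sub_eq_zero.mp
    (tendsto_nhds_unique ((tendsto_coord hl a).sub (tendsto_coord hl b)) h1))

theorem mem_node_iff {l : Filter (Conf n M)} [l.NeBot]
    (hl : l ≤ confNhds f.toFun (compactCoords f x)) {i k a : Fin n} :
    (a = i ∨ Excludes x.1 i a k) ↔ (fun c : Conf n M => f.toFun (c.1 i) - f.toFun (c.1 a))
      =o[l] fun c => f.toFun (c.1 i) - f.toFun (c.1 k) := by
  rw [excludes_iff hl]
  by_cases h : a = i
  · subst h
    simp
  · simp [h, Ne.symm h]

theorem isLittleO_sub_of_isLittleO_sub {l : Filter (Conf n M)} {i a b : Fin n} {E : Type*}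
    [NormedAddCommGroup E] {v : Conf n M → E}
    (ha : (fun c : Conf n M => f.toFun (c.1 i) - f.toFun (c.1 a)) =o[l] v)
    (hb : (fun c : Conf n M => f.toFun (c.1 i) - f.toFun (c.1 b)) =o[l] v) :
    (fun c : Conf n M => f.toFun (c.1 a) - f.toFun (c.1 b)) =o[l] v :=
  (hb.sub ha).congr_left fun c => by abel

theorem exists_base_of_mem_treeOf {A : Set (Fin n)} (hA : A ∈ treeOf x.1) :
    (∃ p, ∀ a ∈ A, x.1.1 a = p) ∧ ∃ a ∈ A, ∃ b ∈ A, a ≠ b := by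
  rcases hA with ⟨i, j, k, hijk, rfl⟩ | ⟨hn, hx, rfl⟩
  · refine ⟨⟨x.1.1 i, fun a ha => ?_⟩, i, Or.inl rfl, j, Or.inr hijk,
      ((excludes_iff (x := x) le_rfl i j k).mp hijk).1⟩
    exact (base_eq_of_isLittleO le_rfl ((mem_node_iff (x := x) le_rfl).mp ha)).symm
  · exact ⟨⟨x.1.1 ⟨0, by omega⟩, fun a _ => hx a _⟩, ⟨0, by omega⟩, mem_univ _, ⟨1, hn⟩,
      mem_univ _, by simp⟩

/-- A vertex contains every leaf that is much closer to one of its leaves than another of its leaves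
is. -/
theorem mem_of_mem_treeOf_of_isLittleO {l : Filter (Conf n M)} [l.NeBot]
    (hl : l ≤ confNhds f.toFun (compactCoords f x)) {A : Set (Fin n)} (hA : A ∈ treeOf x.1)
    {a e b : Fin n} (ha : a ∈ A) (he : e ∈ A)
    (h : (fun c : Conf n M => f.toFun (c.1 a) - f.toFun (c.1 b))
      =o[l] fun c => f.toFun (c.1 a) - f.toFun (c.1 e)) : b ∈ A := by
  rcases hA with ⟨i, j, k, hijk, rfl⟩ | ⟨hn, hx, rfl⟩
  · have ha' := (mem_node_iff hl).mp ha
    have he' := (mem_node_iff hl).mp he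
    refine (mem_node_iff hl).mpr ((ha'.add (h.trans_isBigO
      (isLittleO_sub_of_isLittleO_sub ha' he').isBigO)).congr_left fun c => ?_)
    abel
  · exact mem_univ _

/-- Rescale the points over `A` by their largest distance from one of them. Along an ultrafilter all
the rescaled points converge, and the limits are tangent vectors. -/
theorem exists_isInfinitesimalConf (f : EuclideanEmbedding d M m) (x : compactConf n f)
    {A : Set (Fin n)} (hA : A ∈ treeOf x.1) :
    ∃ (p : M) (y : Fin n → TangentSpace 𝓘(ℝ, EucSp d) p), IsInfinitesimalConf f x.1 A p y := by
  let l : Ultrafilter (Conf n M) := Ultrafilter.of (confNhds f.toFun (compactCoords f x))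
  have hl : (l : Filter (Conf n M)) ≤ confNhds f.toFun (compactCoords f x) := Ultrafilter.of_le _
  obtain ⟨⟨p, hp⟩, i, hi, i', hi', hii'⟩ := exists_base_of_mem_treeOf hA
  let D : Fin n → Fin n → Conf n M → EucSp m := fun a b c => f.toFun (c.1 a) - f.toFun (c.1 b)
  have hDne : ∀ {a b}, a ≠ b → ∀ c, D a b c ≠ 0 := fun hab c => f.sub_ne_zero_of_ne c hab
  have hmax : ∀ᶠ c in l, ∃ j, j ∈ A ∧ ∀ a ∈ A, ‖D i a c‖ ≤ ‖D i j c‖ :=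
    Eventually.of_forall fun c =>
      exists_max_image A (fun a => ‖D i a c‖) A.toFinite ⟨i, hi⟩
  -- The farthest leaf from `i` depends on the configuration, but there are finitely many
  -- candidates, so along the ultrafilter a single `j` serves.
  obtain ⟨j, hj⟩ := Ultrafilter.eventually_exists_iff.mp hmax
  have hjA : j ∈ A := hj.exists.choose_spec.1
  have hij : i ≠ j := by
    rintro rfl
    obtain ⟨c, hc⟩ := hj.exists
    have := hc.2 i' hi'
    simp only [D, sub_self, norm_zero, norm_le_zero_iff] at this
    exact hDne hii' c this
  have hO : ∀ a ∈ A, ∀ b ∈ A, D a b =O[(l : Filter (Conf n M))] D i j := by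
    have h1 : ∀ a ∈ A, D i a =O[(l : Filter (Conf n M))] D i j := fun a ha =>
      IsBigO.of_bound 1 (hj.mono fun c hc => by simpa using hc.2 a ha)
    exact fun a ha b hb => ((h1 b hb).sub (h1 a ha)).congr_left fun c => by simp only [D]; abel
  have hlim : ∀ a ∈ A, ∃ Y, Tendsto (fun c => ‖D i j c‖⁻¹ • D a i c) l (𝓝 Y) := fun a ha => by
    obtain ⟨Y, -, hY⟩ := (isCompact_closedBall (0 : EucSp m) 1).ultrafilter_le_nhds
      (l.map fun c => ‖D i j c‖⁻¹ • D a i c) (by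
        rw [le_principal_iff]
        refine mem_map.mpr ?_
        filter_upwards [hj] with c hc
        rw [mem_preimage, mem_closedBall_zero_iff, norm_smul, norm_inv, norm_norm, inv_mul_eq_div,
          div_le_one₀ (norm_pos_iff.mpr (hDne hij c)), norm_sub_rev]
        exact hc.2 a ha)
    exact ⟨Y, hY⟩
  choose! Y hY using hlim
  have hYsub : ∀ a ∈ A, ∀ b ∈ A, Tendsto (fun c => ‖D i j c‖⁻¹ • D a b c) l (𝓝 (Y a - Y b)) :=
    fun a ha b hb => ((hY a ha).sub (hY b hb)).congr fun c => by
      rw [← smul_sub]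
      simp only [D]
      abel_nf
  have hYiff : ∀ a ∈ A, ∀ b ∈ A, Y a = Y b ↔ D a b =o[(l : Filter (Conf n M))] D i j := by
    intro a ha b hb
    rw [← isLittleO_norm_norm, isLittleO_iff_tendsto fun c hc =>
      absurd (norm_eq_zero.mp hc) (hDne hij c)]
    have h1 : Tendsto (fun c => ‖D a b c‖ / ‖D i j c‖) l (𝓝 ‖Y a - Y b‖) :=
      (hYsub a ha b hb).norm.congr fun c => by
        rw [norm_smul, norm_inv, norm_norm, inv_mul_eq_div]
    rw [← sub_eq_zero, ← norm_eq_zero]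
    exact ⟨fun h => h ▸ h1, fun h => tendsto_nhds_unique h1 h⟩
  have hcoord : ∀ a ∈ A, Tendsto (fun c : Conf n M => f.toFun (c.1 a)) l (𝓝 (f.toFun p)) :=
    fun a ha => hp a ha ▸ tendsto_coord hl a
  have htan : ∀ a ∈ A, ∃ w : TangentSpace 𝓘(ℝ, EucSp d) p, f.push p w = Y a := fun a ha =>
    f.exists_push_eq (hcoord a ha) (hcoord i hi) (hY a ha)
  choose! y hy using htan
  have hyiff : ∀ a ∈ A, ∀ b ∈ A, y a = y b ↔ Y a = Y b := fun a ha b hb => by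
    rw [← hy a ha, ← hy b hb, (f.push_injective p).eq_iff]
  have hysub : ∀ a ∈ A, ∀ b ∈ A, f.push p (y a - y b) = Y a - Y b := fun a ha b hb => by
    rw [f.push_sub, hy a ha, hy b hb]
  have hirrefl : ∀ {a b}, a ≠ b → ¬ D a b =o[(l : Filter (Conf n M))] D a b := fun hab =>
    isLittleO_irrefl (Frequently.of_forall (hDne hab))
  refine ⟨p, y, hp, fun a ha b hb => ?_, fun q hq hne => ?_, fun t ht hne => ?_⟩
  · rw [hyiff a ha b hb, hYiff a ha b hb]
    constructor
    · intro hab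
      by_cases hab' : a = b
      · exact Or.inl hab'
      right
      -- Since `Y i ≠ Y j`, some limit differs from `Y a`. The vertex of leaves much closer to `a`
      -- than `e` is contains `b`, omits `e` and lies in `A`.
      obtain ⟨e, he, hae⟩ : ∃ e ∈ A, Y a ≠ Y e := by
        by_cases h : Y a = Y i
        · exact ⟨j, hjA, fun h' => hirrefl hij ((hYiff i hi j hjA).mp (h.symm.trans h'))⟩
        · exact ⟨i, hi, h⟩
      have hO' := Ultrafilter.isBigO_of_not_isLittleO fun h => hae ((hYiff a ha e he).mpr h)
      have hB : a = a ∨ Excludes x.1 a a e := Or.inl rfl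
      have hb' : Excludes x.1 a b e := (excludes_iff hl a b e).mpr ⟨hab', hab.trans_isBigO hO'⟩
      refine ⟨{k | k = a ∨ Excludes x.1 a k e}, Or.inl ⟨a, b, e, hb', rfl⟩, ?_, hB, Or.inr hb'⟩
      refine (ssubset_iff_of_subset fun k hk => ?_).mpr ⟨e, he, fun hk => ?_⟩
      · exact mem_of_mem_treeOf_of_isLittleO hl hA ha he ((mem_node_iff hl).mp hk)
      · exact hirrefl (fun h : a = e => hae (congrArg Y h)) ((mem_node_iff hl).mp hk)
    · rintro (rfl | ⟨B, hB, hBA, haB, hbB⟩)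
      · simp [D]
      rcases hB with ⟨r, s, k, hrsk, rfl⟩ | ⟨-, -, rfl⟩
      · obtain ⟨e, he, heB⟩ := exists_of_ssubset hBA
        have hrA := hBA.1 (show r ∈ {k' | k' = r ∨ Excludes x.1 r k' k} from Or.inl rfl)
        -- As `e` lies in `A` but not in `B`, the scale `D r k` defining `B` is `O(D r e)`, hence
        -- `O(D i j)`: the leaves of `B` merge after rescaling.
        have hO' := Ultrafilter.isBigO_of_not_isLittleO fun h => heB ((mem_node_iff hl).mpr h)
        have h1 := ((mem_node_iff hl).mp haB).trans_isBigO (hO'.trans (hO r hrA e he))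
        have h2 := ((mem_node_iff hl).mp hbB).trans_isBigO (hO'.trans (hO r hrA e he))
        exact isLittleO_sub_of_isLittleO_sub h1 h2
      · exact absurd (subset_univ A) hBA.2
  · rw [hysub _ (hq 0) _ (hq 1)]
    have h1 := (hYsub _ (hq 0) _ (hq 1)).normalize
      (sub_ne_zero.mpr fun h => hne ((hyiff _ (hq 0) _ (hq 1)).mpr h))
    refine tendsto_nhds_unique (tendsto_unitDirection hl q) (h1.congr fun c => ?_)
    exact norm_inv_smul_smul_of_pos (inv_pos.mpr (norm_pos_iff.mpr (hDne hij c))) _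
  · rw [hysub _ (ht 0) _ (ht 1), hysub _ (ht 0) _ (ht 2)]
    have h1 := (hYsub _ (ht 0) _ (ht 1)).enorm
    have h2 := (hYsub _ (ht 0) _ (ht 2)).enorm
    have hne' : ‖Y (t.1 0) - Y (t.1 1)‖ₑ ≠ 0 ∨ ‖Y (t.1 0) - Y (t.1 2)‖ₑ ≠ 0 := by
      rw [← not_and_or]
      rw [hyiff _ (ht 0) _ (ht 1), hyiff _ (ht 0) _ (ht 2)] at hne
      simpa [sub_eq_zero] using hne
    refine tendsto_nhds_unique (tendsto_ratio hl t)
      ((ENNReal.Tendsto.div h1 hne' h2 (Or.inl (by simp))).congr fun c => ?_)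
    rw [enorm_smul, enorm_smul, ENNReal.mul_div_mul_left _ _ (by simpa using hDne hij c) (by simp)]

end InfinitesimalExistence

/-! ### Induced maps and the theorem -/

section Map

variable {d m d' m' : ℕ} {M N : Type*}
  [TopologicalSpace M] [ChartedSpace (EucSp d) M]
  [TopologicalSpace N] [ChartedSpace (EucSp d') N]

/-- The map between compactified configuration spaces induced by a smooth map that has local
smooth left inverses. -/
noncomputable def compactConfMap (n : ℕ) (f : EuclideanEmbedding d M m) (g : EuclideanEmbedding d' N m')
    {φ : M → N} (hφ : ContMDiff 𝓘(ℝ, EucSp d) 𝓘(ℝ, EucSp d') ∞ φ)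
    (hφ' : HasSmoothRetractions d d' φ) : compactConf n f → compactConf n g :=
  (exists_extendsConfMap n hφ'.injective (f.smoothVia_of_contMDiff (g.contMDiff.comp hφ))
    (f.smoothVia_of_hasSmoothRetractions g hφ')).choose

theorem extendsConfMap_compactConfMap (n : ℕ) (f : EuclideanEmbedding d M m)
    (g : EuclideanEmbedding d' N m') {φ : M → N}
    (hφ : ContMDiff 𝓘(ℝ, EucSp d) 𝓘(ℝ, EucSp d') ∞ φ) (hφ' : HasSmoothRetractions d d' φ) :
    ExtendsConfMap f g hφ'.injective (compactConfMap n f g hφ hφ') :=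
  (exists_extendsConfMap n hφ'.injective (f.smoothVia_of_contMDiff (g.contMDiff.comp hφ))
    (f.smoothVia_of_hasSmoothRetractions g hφ')).choose_spec

theorem smoothEmbeddingVia_compactConfMap (n : ℕ) (f : EuclideanEmbedding d M m)
    (g : EuclideanEmbedding d' N m') {φ : M → N}
    (hφ : ContMDiff 𝓘(ℝ, EucSp d) 𝓘(ℝ, EucSp d') ∞ φ) (hφ' : HasSmoothRetractions d d' φ) :
    SmoothEmbeddingVia (compactCoords f) (compactCoords g) (compactConfMap n f g hφ hφ') :=
  (extendsConfMap_compactConfMap n f g hφ hφ').smoothEmbeddingVia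
    (f.smoothVia_of_contMDiff (g.contMDiff.comp hφ)) (f.smoothVia_of_hasSmoothRetractions g hφ')

/-- The diffeomorphism between compactified configuration spaces induced by a diffeomorphism. -/
noncomputable def compactConfDiffeo (n : ℕ) (f : EuclideanEmbedding d M m) (g : EuclideanEmbedding d' N m')
    (φ : M ≃ₘ^∞⟮𝓘(ℝ, EucSp d), 𝓘(ℝ, EucSp d')⟯ N) : CompactConfDiffeo n f g where
  toFun := compactConfMap n f g φ.contMDiff φ.hasSmoothRetractions
  invFun := compactConfMap n g f φ.symm.contMDiff φ.symm.hasSmoothRetractions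
  left_inv := congrFun (((extendsConfMap_compactConfMap n g f φ.symm.contMDiff
    φ.symm.hasSmoothRetractions).comp (extendsConfMap_compactConfMap n f g φ.contMDiff
      φ.hasSmoothRetractions)).unique extendsConfMap_id (funext φ.symm_apply_apply))
  right_inv := congrFun (((extendsConfMap_compactConfMap n f g φ.contMDiff
    φ.hasSmoothRetractions).comp (extendsConfMap_compactConfMap n g f φ.symm.contMDiff
      φ.symm.hasSmoothRetractions)).unique extendsConfMap_id (funext φ.apply_symm_apply))
  smooth_toFun := (smoothEmbeddingVia_compactConfMap n f g _ _).2.1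
  smooth_invFun := (smoothEmbeddingVia_compactConfMap n g f _ _).2.1

theorem extendsConfMap_compactConfDiffeo (n : ℕ) (f : EuclideanEmbedding d M m)
    (g : EuclideanEmbedding d' N m') (φ : M ≃ₘ^∞⟮𝓘(ℝ, EucSp d), 𝓘(ℝ, EucSp d')⟯ N) :
    ExtendsConfMap f g φ.injective (compactConfDiffeo n f g φ).toEquiv :=
  extendsConfMap_compactConfMap n f g φ.contMDiff φ.hasSmoothRetractions

end Map

theorem mainTheorem7 (n : ℕ) :
    -- up to diffeomorphism, `C_n[M]` does not depend on the embedding of `M`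
    (∀ (d m m' : ℕ) (M : Type u) [TopologicalSpace M] [ChartedSpace (EucSp d) M]
      [IsManifold 𝓘(ℝ, EucSp d) ∞ M]
      (f : EuclideanEmbedding d M m) (g : EuclideanEmbedding d M m'),
      ∃ Φ : CompactConfDiffeo n f g,
        ∀ x : Conf n M, Φ.toEquiv (toCompactConf n f x) = toCompactConf n g x) ∧
    -- functoriality of `C_n[-]` for embeddings
    (∃ C : ∀ {X Y : EmbeddedManifold.{u}}, ManifoldEmb X Y →
        compactConf n X.emb → compactConf n Y.emb,
      (∀ X : EmbeddedManifold.{u}, C (ManifoldEmb.refl X) = id) ∧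
      (∀ (X Y Z : EmbeddedManifold.{u}) (φ : ManifoldEmb X Y) (ψ : ManifoldEmb Y Z)
        (χ : ManifoldEmb X Z), χ.toFun = ψ.toFun ∘ φ.toFun → C χ = C ψ ∘ C φ) ∧
      (∀ (X Y : EmbeddedManifold.{u}) (φ : ManifoldEmb X Y),
        SmoothEmbeddingVia (compactCoords X.emb) (compactCoords Y.emb) (C φ) ∧
        -- it extends `C_n(M) → C_n(N)` and lifts `M^n → N^n`
        (∀ x : Conf n X.carrier, C φ (toCompactConf n X.emb x) =
          toCompactConf n Y.emb (x.map φ.toFun φ.isSmoothEmbedding.isEmbedding.injective)) ∧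
        (∀ (x : compactConf n X.emb) (i : Fin n), (C φ x).1.1 i = φ.toFun (x.1.1 i)) ∧
        -- it respects the strata
        (∀ (T : Set (Set (Fin n))) (x : compactConf n X.emb),
          C φ x ∈ stratum Y.emb T ↔ x ∈ stratum X.emb T) ∧
        -- on the infinitesimal configurations that describe a point it is the differential
        (∀ (x : compactConf n X.emb), ∀ A ∈ treeOf x.1,
          (∃ (p : X.carrier) (y : Fin n → TangentSpace 𝓘(ℝ, EucSp X.dim) p),
            IsInfinitesimalConf X.emb x.1 A p y) ∧
          ∀ (p : X.carrier) (y : Fin n → TangentSpace 𝓘(ℝ, EucSp X.dim) p),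
            IsInfinitesimalConf X.emb x.1 A p y →
            IsInfinitesimalConf Y.emb (C φ x).1 A (φ.toFun p) (fun i => φ.push p (y i))))) ∧
    -- the diffeomorphism group of `M` acts on `C_n[M]` by diffeomorphisms
    (∀ X : EmbeddedManifold.{u},
      ∃ a : (X.carrier ≃ₘ^∞⟮𝓘(ℝ, EucSp X.dim), 𝓘(ℝ, EucSp X.dim)⟯ X.carrier) →
          CompactConfDiffeo n X.emb X.emb,
        (∀ x, (a (Diffeomorph.refl _ _ _)).toEquiv x = x) ∧
        (∀ φ ψ x, (a (φ.trans ψ)).toEquiv x = (a ψ).toEquiv ((a φ).toEquiv x)) ∧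
        (∀ φ (x : Conf n X.carrier), (a φ).toEquiv (toCompactConf n X.emb x) =
          toCompactConf n X.emb (x.map φ φ.injective)) ∧
        (∀ φ (x : compactConf n X.emb) (i : Fin n),
          ((a φ).toEquiv x).1.1 i = φ (x.1.1 i))) := by
  -- Independence of the embedding is the case of the identity of `M`, seen through `f` on one side
  -- and `g` on the other.
  refine ⟨fun d m m' M _ _ _ f g => ⟨compactConfDiffeo n f g (Diffeomorph.refl _ M _), fun c => ?_⟩,
    ⟨fun {X Y} φ => compactConfMap n X.emb Y.emb φ.isSmoothEmbedding.contMDiff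
      φ.isSmoothEmbedding.hasSmoothRetractions, fun X => ?_, fun X Y Z φ ψ χ h => ?_,
      fun X Y φ => ?_⟩,
    fun X => ⟨fun φ => compactConfDiffeo n X.emb X.emb φ, fun x => ?_, fun φ ψ x => ?_,
      fun φ c => ?_, fun φ x i => ?_⟩⟩
  · exact (extendsConfMap_compactConfDiffeo n f g (Diffeomorph.refl _ M _)).apply_toCompactConf c
  · exact (extendsConfMap_compactConfMap n X.emb X.emb _ _).unique extendsConfMap_id rfl
  · exact (extendsConfMap_compactConfMap n X.emb Z.emb _ _).unique
      ((extendsConfMap_compactConfMap n Y.emb Z.emb _ _).comp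
        (extendsConfMap_compactConfMap n X.emb Y.emb _ _)) h
  · have hφ := φ.isSmoothEmbedding.contMDiff
    have hφ' := φ.isSmoothEmbedding.hasSmoothRetractions
    have S := X.emb.smoothVia_of_contMDiff (Y.emb.contMDiff.comp hφ)
    have S' := X.emb.smoothVia_of_hasSmoothRetractions Y.emb hφ'
    have hF := extendsConfMap_compactConfMap n X.emb Y.emb hφ hφ'
    refine ⟨smoothEmbeddingVia_compactConfMap n X.emb Y.emb hφ hφ', hF.apply_toCompactConf,
      hF.base_apply S, fun T x => ?_, fun x A hA => ⟨exists_isInfinitesimalConf X.emb x hA,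
        fun p y h => hF.isInfinitesimalConf S S' hφ hφ' h⟩⟩
    exact Eq.congr_left (hF.treeOf_eq S S' x)
  · exact congrFun ((extendsConfMap_compactConfDiffeo n X.emb X.emb _).unique
      extendsConfMap_id rfl) x
  · exact congrFun ((extendsConfMap_compactConfDiffeo n X.emb X.emb (φ.trans ψ)).unique
      ((extendsConfMap_compactConfDiffeo n X.emb X.emb ψ).comp
        (extendsConfMap_compactConfDiffeo n X.emb X.emb φ)) rfl) x
  · exact (extendsConfMap_compactConfDiffeo n X.emb X.emb φ).apply_toCompactConf c
  · exact (extendsConfMap_compactConfDiffeo n X.emb X.emb φ).base_apply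
      (X.emb.smoothVia_of_contMDiff (X.emb.contMDiff.comp φ.contMDiff)) x i
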